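/- **Setting.** For a permutation $x\in S_n$ with non-trivial cycles of lengths $c_1,\dots,c_r\ge 2$, the *modified cycle type* of $x$ is the partition with parts $c_1-1,\dots,c_r-1$, and $\|x\|=\sum_i(c_i-1)$. Since $\|xy\|\le\|x\|+\|y\|$, the group ring $\mathbb Z[S_n]$ is filtered by $\|\cdot\|$; in its associated graded ring the product is $x\star y=xy$ if $\|xy\|=\|x\|+\|y\|$ and $x\star y=0$ otherwise. Let $\mathcal G(n)$ be the subring of class functions of this graded ring, and for a partition $\lambda$ let $K_\lambda(n)\in\mathcal G(n)$ be the sum of all permutations in $S_n$ of modified cycle type $\lambda$. The *Farahat–Higman ring* $\mathcal G$ is the inverse limit (as graded rings) of the rings $\mathcal G(n)$ under the restriction maps $\mathcal G(n+1)\to\mathcal G(n)$; the families $(K_\lambda(n))_n$ define elements $K_\lambda$ which form a $\mathbb Z$-basis of $\mathcal G$. Let $\Lambda$ be the ring of symmetric functions over $\mathbb Z$, with the elementary, complete, power sum, monomial and Schur functions $e_k,h_k,p_k,m_\lambda,s_\lambda$, where $h_\lambda=h_{\lambda_1}h_{\lambda_2}\cdots$. Let $\langle\cdot,\cdot\rangle$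 be the standard bilinear form, $\langle h_\lambda,m_\mu\rangle=\delta_{\lambda\mu}$, and let $\omega$ be the standard involution, i.e. the ring automorphism of $\Lambda$ switching $e_k$ and $h_k$ for all $k$. Define $h_k^*\in\Lambda$ by inverting $u=t+h_1t^2+h_2t^3+\cdots$ as $t=u+h_1^*u^2+h_2^*u^3+\cdots$, put $h_\lambda^*=h^*_{\lambda_1}h^*_{\lambda_2}\cdots$, and let $(g_\lambda)$ be the dual family: $\langle g_\lambda,h^*_\mu\rangle=\delta_{\lambda\mu}$. In $S_n$ let $\xi_j=\xi_{j;n}=\sum_{i<j}(i,j)$, $1\le j\le n$, be the Jucys–Murphy elements, which commute under $\star$. For $k\ge1$ put $(-\Xi)^{\star k}(n)=\sum_{j=1}^n(-1)^k\,\xi_j^{\star k}$, and let $e_k^\star(-\Xi_n)$, $h_k^\star(-\Xi_n)$, $s_\lambda^\star(-\Xi_n)$ be the values of $e_k,h_k,s_\lambda$ at $-\xi_1,\dots,-\xi_n$, computed with the product $\star$. **Theorem 5.8.** The form $\langle\cdot,\cdot\rangle$, the automorphism $\omega$ and the family $(g_\lambda)$ exist and are unique, and there is a unique ring isomorphism $\phi:\mathcal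 G\to\Lambda$ such that 1. $\phi(K_\lambda)=g_\lambda$ for all partitions $\lambda$. Moreover, for every $k\ge1$ in (2), every $k\ge0$ in (3) and (4), and every partition $\lambda$ in (5), the elements $(-\Xi)^{\star k}(n)$, $e_k^\star(-\Xi_n)$, $h_k^\star(-\Xi_n)$, $s_\lambda^\star(-\Xi_n)$ ($n\ge0$) are the components of elements $(-\Xi)^{\star k}$, $e_k^\star(-\Xi)$, $h_k^\star(-\Xi)$, $s_\lambda^\star(-\Xi)$ of $\mathcal G$, and 2. $\omega\phi\big((-\Xi)^{\star k}\big)=p_k$; 3. $\omega\phi\big(e_k^\star(-\Xi)\big)=e_k$; 4. $\omega\phi\big(h_k^\star(-\Xi)\big)=h_k$; 5. $\omega\phi\big(s_\lambda^\star(-\Xi)\big)=s_\lambda$. -/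

import Mathlib

set_option linter.unusedSectionVars false

open MvPolynomial in
/-- Setting the last variable to zero: `f(x₀, …, xₙ) ↦ f(x₀, …, xₙ₋₁, 0)`. -/
noncomputable def killLast (n : ℕ) :
    MvPolynomial (Fin (n + 1)) ℤ →ₐ[ℤ] MvPolynomial (Fin n) ℤ :=
  aeval (Fin.snoc (α := fun _ => MvPolynomial (Fin n) ℤ) X 0)

/-- The ring `Λ` of symmetric functions over `ℤ` in infinitely many variables, as the inverse
limit, in the category of graded rings, of the rings of symmetric polynomials in `n` variables:
its elements are the compatible families of symmetric polynomials of bounded degree. -/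
noncomputable def SymFun : Subring (∀ n : ℕ, MvPolynomial (Fin n) ℤ) where
  carrier := {f | (∀ n, (f n).IsSymmetric) ∧ (∀ n, killLast n (f (n + 1)) = f n) ∧
    ∃ N : ℕ, ∀ n, (f n).totalDegree ≤ N}
  mul_mem' := by
    rintro f g ⟨hf1, hf2, N, hN⟩ ⟨hg1, hg2, M, hM⟩
    refine ⟨fun n => (hf1 n).mul (hg1 n), fun n => by simp [hf2, hg2], N + M, fun n => ?_⟩
    exact (MvPolynomial.totalDegree_mul _ _).trans (add_le_add (hN n) (hM n))
  one_mem' := ⟨fun n => MvPolynomial.IsSymmetric.one, fun n => by simp, 0, fun n => by simp⟩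
  add_mem' := by
    rintro f g ⟨hf1, hf2, N, hN⟩ ⟨hg1, hg2, M, hM⟩
    refine ⟨fun n => (hf1 n).add (hg1 n), fun n => by simp [hf2, hg2], max N M, fun n => ?_⟩
    exact (MvPolynomial.totalDegree_add _ _).trans (max_le_max (hN n) (hM n))
  zero_mem' := ⟨fun n => MvPolynomial.IsSymmetric.zero, fun n => by simp, 0, fun n => by simp⟩
  neg_mem' := by
    rintro f ⟨hf1, hf2, N, hN⟩
    exact ⟨fun n => (hf1 n).neg, fun n => by simp [hf2], N, fun n => by simpa using hN n⟩

/-- A partition of some non-negative integer (its weight `lam.1`). -/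
abbrev Ptn : Type := Σ m : ℕ, m.Partition

namespace SymFun

open MvPolynomial

theorem killLast_castSucc {n : ℕ} (i : Fin n) : killLast n (X i.castSucc) = X i := by
  simp [killLast]

theorem killLast_last (n : ℕ) : killLast n (X (Fin.last n)) = 0 := by
  simp [killLast]

theorem totalDegree_prod_X_le {n : ℕ} (s : Multiset (Fin n)) :
    ((s.map (X : Fin n → MvPolynomial (Fin n) ℤ)).prod).totalDegree ≤ s.card := by
  refine (totalDegree_multiset_prod _).trans ?_
  rw [Multiset.map_map]
  refine (Multiset.sum_le_card_nsmul _ 1 ?_).trans ?_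
  · intro x hx
    obtain ⟨i, -, rfl⟩ := Multiset.mem_map.1 hx
    simp
  · simp

theorem killLast_sum_sym {n k : ℕ} (P : Sym (Fin (n + 1)) k → Prop) (Q : Sym (Fin n) k → Prop)
    [DecidablePred P] [DecidablePred Q] (h : ∀ s, P (s.map Fin.castSucc) ↔ Q s) :
    killLast n (∑ s with P s, (s.1.map X).prod) = ∑ s with Q s, (s.1.map X).prod := by
  rw [map_sum]
  symm
  refine Finset.sum_of_injOn (Sym.map Fin.castSucc) ?_ ?_ ?_ ?_
  · exact (Sym.map_injective (Fin.castSucc_injective n) k).injOn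
  · intro s hs
    simpa [h] using hs
  · intro s hs hs'
    have : Fin.last n ∈ s := by
      by_contra hl
      apply hs'
      have hx : ∀ a ∈ s, ∃ b : Fin n, b.castSucc = a := by
        intro a ha
        refine Fin.exists_castSucc_eq.2 ?_
        rintro rfl
        exact hl ha
      choose b hb using hx
      have e : Sym.map Fin.castSucc (Sym.map (fun x : {x // x ∈ s} => b x.1 x.2) s.attach) = s := by
        rw [Sym.map_map]
        conv_rhs => rw [← Sym.attach_map_coe s]
        refine Sym.map_congr ?_
        intro x _
        simp [hb]
      refine ⟨_, ?_, e⟩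
      simp only [Finset.coe_filter, Finset.mem_univ, true_and, Set.mem_ofPred_eq]
      rw [← h, e]
      simpa using hs
    rw [map_multiset_prod, Multiset.map_map]
    apply Multiset.prod_eq_zero
    rw [Multiset.mem_map]
    exact ⟨_, this, by simp [killLast_last]⟩
  · intro s _
    rw [map_multiset_prod, Multiset.map_map]
    congr 1
    change _ = Multiset.map _ (Multiset.map _ s.1)
    rw [Multiset.map_map]
    refine Multiset.map_congr rfl ?_
    intro a _
    simp [killLast_castSucc]

/-- The elementary symmetric function `e_k`. -/
noncomputable def e (k : ℕ) : SymFun :=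
  ⟨fun n => esymm (Fin n) ℤ k, fun n => esymm_isSymmetric _ _ k, fun n => by
    dsimp only
    rw [killLast, aeval_esymm_eq_multiset_esymm, esymm_eq_multiset_esymm]
    have h : (Finset.univ : Finset (Fin (n + 1))).val.map
        (Fin.snoc (α := fun _ => MvPolynomial (Fin n) ℤ) X 0) =
        0 ::ₘ (Finset.univ : Finset (Fin n)).val.map X := by
      rw [Fin.univ_castSuccEmb]
      simp
    rw [h]
    cases k with
    | zero => simp [Multiset.esymm]
    | succ k =>
      rw [Multiset.esymm, Multiset.powersetCard_cons, Multiset.map_add, Multiset.sum_add,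
        Multiset.map_map, Multiset.esymm]
      simp only [Function.comp_def, Multiset.prod_cons, zero_mul, Multiset.map_const',
        Multiset.sum_replicate, smul_zero, add_zero], k, fun n => by
    dsimp only
    rw [esymm]
    refine totalDegree_finsetSum_le fun s hs => ?_
    have := totalDegree_prod_X_le s.1
    simp only [Finset.mem_powersetCard] at hs
    simpa [hs.2] using this⟩

/-- The complete symmetric function `h_k`. -/
noncomputable def h (k : ℕ) : SymFun :=
  ⟨fun n => hsymm (Fin n) ℤ k, fun n => hsymm_isSymmetric _ _ k, fun n => by
    simpa [hsymm] using killLast_sum_sym (n := n) (k := k) (fun _ => True) (fun _ => True) (by simp),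
    k, fun n => by
    refine totalDegree_finsetSum_le fun s hs => ?_
    simpa using totalDegree_prod_X_le s.1⟩

/-- The power sum symmetric function `p_k`, for `k ≥ 1`. -/
noncomputable def p (k : ℕ) (hk : 1 ≤ k) : SymFun :=
  ⟨fun n => psum (Fin n) ℤ k, fun n => psum_isSymmetric _ _ k, fun n => by
    have hk' : k ≠ 0 := by omega
    simp [psum, Fin.sum_univ_castSucc, killLast_castSucc, killLast_last, hk'],
    k, fun n => by
    refine totalDegree_finsetSum_le fun i _ => ?_
    simp⟩

theorem msymm_eq (n : ℕ) (lam : Ptn) : msymm (Fin n) ℤ lam.2 =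
    ∑ s : Sym (Fin n) lam.1 with Nat.Partition.ofSym s = lam.2, (s.1.map X).prod := by
  rw [msymm]
  symm
  exact Finset.sum_subtype _ (by simp) _

/-- The monomial symmetric function `m_λ`. -/
noncomputable def m (lam : Ptn) : SymFun :=
  ⟨fun n => msymm (Fin n) ℤ lam.2, fun n => msymm_isSymmetric _ _ lam.2, fun n => by
    dsimp only
    rw [msymm_eq, msymm_eq]
    refine killLast_sum_sym _ _ fun s => ?_
    have : Nat.Partition.ofSym (s.map Fin.castSucc) = Nat.Partition.ofSym s := by
      ext1
      have hi := Fin.castSucc_injective n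
      simp [Nat.Partition.ofSym, Multiset.dedup_map_of_injective hi,
        Multiset.count_map_eq_count' _ _ hi]
    rw [this],
    lam.1, fun n => by
    dsimp only
    rw [msymm_eq]
    refine totalDegree_finsetSum_le fun s hs => ?_
    simpa using totalDegree_prod_X_le s.1⟩

end SymFun
/-- The Young diagram of a partition. -/
def Ptn.diagram (lam : Ptn) : YoungDiagram :=
  YoungDiagram.ofRowLens (lam.2.parts.sort (· ≥ ·)) (Multiset.pairwise_sort _ _).sortedGE

/-- Semistandard Young tableaux with entries in `{0, …, n - 1}`. -/
abbrev BddSSYT (mu : YoungDiagram) (n : ℕ) : Type :=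
  {T : SemistandardYoungTableau mu // ∀ c ∈ mu.cells, T c.1 c.2 < n}

theorem BddSSYT.toFun_injective (mu : YoungDiagram) (n : ℕ) : Function.Injective
    (fun (T : BddSSYT mu n) (c : mu.cells) => (⟨T.1 c.1.1 c.1.2, T.2 c.1 c.2⟩ : Fin n)) := by
  intro T T' hT
  ext i j
  by_cases hc : (i, j) ∈ mu
  · simpa using congrFun hT ⟨(i, j), by simpa using hc⟩
  · rw [T.1.zeros hc, T'.1.zeros hc]

noncomputable instance (mu : YoungDiagram) (n : ℕ) : Fintype (BddSSYT mu n) :=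
  Fintype.ofInjective _ (BddSSYT.toFun_injective mu n)

namespace SymFun

open MvPolynomial

/-- The variable `x_a` of the polynomial ring in `x₀, …, xₙ₋₁` (with `x_a = 0` for `a ≥ n`). -/
noncomputable def var (n a : ℕ) : MvPolynomial (Fin n) ℤ :=
  if h : a < n then X ⟨a, h⟩ else 0

/-- The Schur polynomial in `n` variables: the sum over semistandard Young tableaux with entries
in `{0, …, n - 1}` of the product of the variables indexed by the entries. -/
noncomputable def schurPoly (mu : YoungDiagram) (n : ℕ) : MvPolynomial (Fin n) ℤ :=
  ∑ T : BddSSYT mu n, ∏ c ∈ mu.cells, var n (T.1 c.1 c.2)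

theorem killLast_var (n a : ℕ) : killLast n (var (n + 1) a) = var n a := by
  unfold var
  by_cases h : a < n
  · rw [dif_pos h, dif_pos (by omega)]
    exact killLast_castSucc ⟨a, h⟩
  · rw [dif_neg h]
    by_cases h' : a < n + 1
    · rw [dif_pos h']
      have : (⟨a, h'⟩ : Fin (n + 1)) = Fin.last n := by ext; simp; omega
      rw [this, killLast_last]
    · rw [dif_neg h', map_zero]

theorem killLast_schurPoly (mu : YoungDiagram) (n : ℕ) :
    killLast n (schurPoly mu (n + 1)) = schurPoly mu n := by
  simp only [schurPoly, map_sum, map_prod, killLast_var]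
  symm
  refine Finset.sum_of_injOn (fun T => ⟨T.1, fun c hc => (T.2 c hc).trans (Nat.lt_succ_self n)⟩)
    ?_ (by simp) ?_ (by simp)
  · intro T _ T' _ h
    ext1
    exact congrArg (fun x => x.1) h
  · intro T _ hT
    by_cases hb : ∀ c ∈ mu.cells, T.1 c.1 c.2 < n
    · exact absurd ⟨⟨T.1, hb⟩, by simp, rfl⟩ hT
    · push Not at hb
      obtain ⟨c, hc, hcn⟩ := hb
      exact Finset.prod_eq_zero hc (by rw [var, dif_neg (by omega)])

theorem totalDegree_schurPoly_le (mu : YoungDiagram) (n : ℕ) :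
    (schurPoly mu n).totalDegree ≤ mu.card := by
  refine totalDegree_finsetSum_le fun T _ => ?_
  refine (totalDegree_finsetProd _ _).trans ?_
  refine (Finset.sum_le_card_nsmul _ _ 1 fun c _ => ?_).trans (by simp)
  unfold var
  split_ifs <;> simp

section BenderKnuth

variable {mu : YoungDiagram} (T : SemistandardYoungTableau mu) (k : ℕ)

/-- The number of entries smaller than `v` in row `i`. -/
def cnt (i v : ℕ) : ℕ := ((Finset.range (mu.rowLen i)).filter fun j => T i j < v).card

theorem cnt_le_rowLen (i v : ℕ) : cnt T i v ≤ mu.rowLen i := by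
  simpa [cnt] using Finset.card_filter_le (Finset.range (mu.rowLen i)) fun j => T i j < v

theorem lt_iff_lt_cnt {i j : ℕ} (hc : (i, j) ∈ mu) (v : ℕ) : T i j < v ↔ j < cnt T i v := by
  have hj := YoungDiagram.mem_iff_lt_rowLen.1 hc
  constructor
  · intro h
    have : Finset.range (j + 1) ⊆ (Finset.range (mu.rowLen i)).filter fun j => T i j < v := by
      intro a ha
      simp only [Finset.mem_range, Finset.mem_filter] at ha ⊢
      exact ⟨by omega, lt_of_le_of_lt (T.row_weak_of_le (by omega) hc) h⟩
    simpa [cnt] using Finset.card_le_card this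
  · intro h
    by_contra hv
    have : ((Finset.range (mu.rowLen i)).filter fun j => T i j < v) ⊆ Finset.range j := by
      intro a ha
      simp only [Finset.mem_range, Finset.mem_filter] at ha ⊢
      by_contra haj
      have := T.row_weak_of_le (not_lt.1 haj) (YoungDiagram.mem_iff_lt_rowLen.2 ha.1)
      omega
    have := Finset.card_le_card this
    rw [Finset.card_range] at this
    unfold cnt at h
    omega

theorem cnt_eq_of {i v b : ℕ} (hb : b ≤ mu.rowLen i)
    (h : ∀ j, (i, j) ∈ mu → (T i j < v ↔ j < b)) : cnt T i v = b := by
  have : ((Finset.range (mu.rowLen i)).filter fun j => T i j < v) = Finset.range b := by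
    ext j
    simp only [Finset.mem_filter, Finset.mem_range]
    constructor
    · rintro ⟨h1, h2⟩
      exact (h j (YoungDiagram.mem_iff_lt_rowLen.2 h1)).1 h2
    · intro hj
      exact ⟨by omega, (h j (YoungDiagram.mem_iff_lt_rowLen.2 (by omega))).2 hj⟩
  rw [cnt, this, Finset.card_range]

theorem cnt_mono (i : ℕ) {v w : ℕ} (h : v ≤ w) : cnt T i v ≤ cnt T i w := by
  refine Finset.card_le_card fun j hj => ?_
  simp only [Finset.mem_filter] at hj ⊢
  exact ⟨hj.1, by omega⟩

theorem cnt_succ_le (i v : ℕ) : cnt T (i + 1) (v + 1) ≤ cnt T i v := by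
  by_contra h
  push Not at h
  have h1 : cnt T i v < mu.rowLen (i + 1) := lt_of_lt_of_le h (cnt_le_rowLen T _ _)
  have hc := YoungDiagram.mem_iff_lt_rowLen.2 h1
  have h2 := (lt_iff_lt_cnt T hc (v + 1)).2 h
  have h3 := T.col_strict (i1 := i) (i2 := i + 1) (by omega) hc
  have hc' := mu.up_left_mem (i1 := i) (i2 := i + 1) (by omega) le_rfl hc
  have h4 := (lt_iff_lt_cnt T hc' v).1 (by omega)
  omega

/-- The least possible value of `cnt T i (k + 1)`, the other values of `cnt` being fixed. -/
def bkLo (i : ℕ) : ℕ := max (cnt T i k) (cnt T (i + 1) (k + 2))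

/-- The largest possible value of `cnt T i (k + 1)`, the other values of `cnt` being fixed. -/
def bkHi : ℕ → ℕ
  | 0 => cnt T 0 (k + 2)
  | i + 1 => min (cnt T (i + 1) (k + 2)) (cnt T i k)

theorem bkLo_le (i : ℕ) : bkLo T k i ≤ cnt T i (k + 1) :=
  max_le (cnt_mono T i (by omega)) (cnt_succ_le T i (k + 1))

theorem le_bkHi (i : ℕ) : cnt T i (k + 1) ≤ bkHi T k i := by
  cases i with
  | zero => exact cnt_mono T 0 (by omega)
  | succ i => exact le_min (cnt_mono T _ (by omega)) (cnt_succ_le T i k)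

theorem bkHi_le (i : ℕ) : bkHi T k i ≤ cnt T i (k + 2) := by
  cases i with
  | zero => exact le_rfl
  | succ i => exact min_le_left _ _

/-- The reflected value of `cnt T i (k + 1)`. -/
def bkCut (i : ℕ) : ℕ := bkLo T k i + bkHi T k i - cnt T i (k + 1)

theorem bkCut_bounds (i : ℕ) : cnt T i k ≤ bkCut T k i ∧ bkCut T k i ≤ cnt T i (k + 2) ∧
    cnt T (i + 1) (k + 2) ≤ bkCut T k i ∧ bkCut T k (i + 1) ≤ cnt T i k := by
  have h1 := bkLo_le T k i
  have h2 := le_bkHi T k i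
  have h3 := bkHi_le T k i
  have h4 := bkLo_le T k (i + 1)
  have h5 := le_bkHi T k (i + 1)
  have h6 : bkHi T k (i + 1) ≤ cnt T i k := min_le_right _ _
  have h7 : cnt T i k ≤ bkLo T k i := le_max_left _ _
  have h8 : cnt T (i + 1) (k + 2) ≤ bkLo T k i := le_max_right _ _
  unfold bkCut
  omega

/-- The Bender–Knuth involution. -/
def bk : SemistandardYoungTableau mu where
  entry i j := if (i, j) ∈ mu then
    (if T i j = k ∨ T i j = k + 1 then (if j < bkCut T k i then k else k + 1) else T i j) else 0
  row_weak' := by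
    intro i j1 j2 hj hc
    rw [if_pos hc, if_pos (mu.up_left_mem le_rfl hj.le hc)]
    have := T.row_weak hj hc
    split_ifs <;> omega
  col_strict' := by
    intro i1 i2 j hi hc
    rw [if_pos hc, if_pos (mu.up_left_mem hi.le le_rfl hc)]
    have h := T.col_strict hi hc
    by_cases h1 : T i1 j = k ∨ T i1 j = k + 1
    · by_cases h2 : T i2 j = k ∨ T i2 j = k + 1
      · have h1' : T i1 j = k := by omega
        have h2' : T i2 j = k + 1 := by omega
        have hi' : i2 = i1 + 1 := by
          by_contra hne
          have h3 := T.col_strict (i1 := i1) (i2 := i1 + 1) (j := j) (by omega)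
            (mu.up_left_mem (by omega) le_rfl hc)
          have h4 := T.col_strict (i1 := i1 + 1) (i2 := i2) (j := j) (by omega) hc
          omega
        subst hi'
        have hb := bkCut_bounds T k i1
        have h5 := (lt_iff_lt_cnt T hc (k + 2)).1 (by omega)
        have h6 := (lt_iff_lt_cnt T (mu.up_left_mem hi.le le_rfl hc) k).not.1 (by omega)
        rw [if_pos h1, if_pos h2, if_pos (by omega), if_neg (by omega)]
        omega
      · rw [if_pos h1, if_neg h2]
        split_ifs <;> omega
    · rw [if_neg h1]
      split_ifs <;> omega
  zeros' := by
    intro i j hc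
    rw [if_neg hc]

theorem bk_apply {i j : ℕ} (hc : (i, j) ∈ mu) : bk T k i j =
    if T i j = k ∨ T i j = k + 1 then (if j < bkCut T k i then k else k + 1) else T i j :=
  if_pos hc

theorem cnt_bk (i : ℕ) {v : ℕ} (hv : v ≠ k + 1) : cnt (bk T k) i v = cnt T i v := by
  refine cnt_eq_of _ (cnt_le_rowLen T i v) fun j hc => ?_
  rw [← lt_iff_lt_cnt T hc, bk_apply T k hc]
  split_ifs <;> omega

theorem cnt_bk_mid (i : ℕ) : cnt (bk T k) i (k + 1) = bkCut T k i := by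
  have hb := bkCut_bounds T k i
  refine cnt_eq_of _ (hb.2.1.trans (cnt_le_rowLen T i _)) fun j hc => ?_
  have h1 := lt_iff_lt_cnt T hc k
  have h2 := lt_iff_lt_cnt T hc (k + 2)
  rw [bk_apply T k hc]
  split_ifs <;> omega

theorem bkCut_bk (i : ℕ) : bkCut (bk T k) k i = cnt T i (k + 1) := by
  have h1 : bkLo (bk T k) k i = bkLo T k i := by
    simp [bkLo, cnt_bk]
  have h2 : bkHi (bk T k) k i = bkHi T k i := by
    cases i <;> simp [bkHi, cnt_bk]
  have h3 := bkLo_le T k i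
  have h4 := le_bkHi T k i
  rw [bkCut, h1, h2, cnt_bk_mid, bkCut]
  omega

theorem bk_bk : bk (bk T k) k = T := by
  ext i j
  by_cases hc : (i, j) ∈ mu
  · rw [bk_apply _ k hc, bkCut_bk, bk_apply T k hc]
    have h1 := lt_iff_lt_cnt T hc (k + 1)
    split_ifs <;> omega
  · rw [SemistandardYoungTableau.zeros _ hc, SemistandardYoungTableau.zeros _ hc]

theorem card_lt_eq_sum (v : ℕ) : (mu.cells.filter fun c => T c.1 c.2 < v).card =
    ∑ i ∈ Finset.range (mu.colLen 0), cnt T i v := by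
  rw [Finset.card_eq_sum_card_fiberwise (f := fun c => c.1) (t := Finset.range (mu.colLen 0))]
  · refine Finset.sum_congr rfl fun i _ => ?_
    rw [cnt]
    refine Finset.card_nbij' (fun c => c.2) (fun j => (i, j)) ?_ ?_ ?_ ?_
    · rintro ⟨a, b⟩ hc
      simp only [Finset.coe_filter, Finset.mem_filter, YoungDiagram.mem_cells,
        Set.mem_ofPred_eq] at hc
      obtain ⟨⟨h1, h2⟩, rfl⟩ := hc
      simpa [← YoungDiagram.mem_iff_lt_rowLen, h2] using h1
    · intro j hj
      simpa [YoungDiagram.mem_iff_lt_rowLen] using hj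
    · rintro ⟨a, b⟩ hc
      simp only [Finset.coe_filter, Finset.mem_filter, YoungDiagram.mem_cells,
        Set.mem_ofPred_eq] at hc
      simp [hc.2]
    · intro j _
      rfl
  · rintro ⟨a, b⟩ hc
    simp only [Finset.coe_filter, YoungDiagram.mem_cells, Set.mem_ofPred_eq] at hc
    simpa [← YoungDiagram.mem_iff_lt_colLen] using mu.up_left_mem le_rfl (Nat.zero_le b) hc.1

theorem sum_bk (R : ℕ) : ∑ i ∈ Finset.range R, (bkLo T k i + bkHi T k i) + bkHi T k R =
    ∑ i ∈ Finset.range R, cnt T i k + ∑ i ∈ Finset.range (R + 1), cnt T i (k + 2) := by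
  induction R with
  | zero => simp [bkHi]
  | succ R ih =>
    rw [Finset.sum_range_succ, Finset.sum_range_succ (fun i => cnt T i k),
      Finset.sum_range_succ (fun i => cnt T i (k + 2))]
    have : bkLo T k R + bkHi T k (R + 1) = cnt T R k + cnt T (R + 1) (k + 2) := by
      simp only [bkLo, bkHi]
      omega
    omega

theorem card_lt_bk : (mu.cells.filter fun c => bk T k c.1 c.2 < k + 1).card +
    (mu.cells.filter fun c => T c.1 c.2 < k + 1).card =
    (mu.cells.filter fun c => T c.1 c.2 < k).card +
    (mu.cells.filter fun c => T c.1 c.2 < k + 2).card := by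
  simp only [card_lt_eq_sum, cnt_bk_mid]
  have h := sum_bk T k (mu.colLen 0)
  have hz : cnt T (mu.colLen 0) (k + 2) = 0 := by
    have h1 := cnt_le_rowLen T (mu.colLen 0) (k + 2)
    have h2 : ¬ 0 < mu.rowLen (mu.colLen 0) := by
      rw [← YoungDiagram.mem_iff_lt_rowLen, YoungDiagram.mem_iff_lt_colLen]
      exact lt_irrefl _
    omega
  have hz' : bkHi T k (mu.colLen 0) = 0 := by
    have := bkHi_le T k (mu.colLen 0)
    omega
  rw [Finset.sum_range_succ, hz, hz', add_zero, add_zero] at h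
  rw [← Finset.sum_add_distrib, ← h]
  refine Finset.sum_congr rfl fun i _ => ?_
  have h3 := bkLo_le T k i
  have h4 := le_bkHi T k i
  unfold bkCut
  omega

theorem card_eq_add (v : ℕ) : (mu.cells.filter fun c => T c.1 c.2 < v + 1).card =
    (mu.cells.filter fun c => T c.1 c.2 < v).card +
    (mu.cells.filter fun c => T c.1 c.2 = v).card := by
  rw [← Finset.card_union_of_disjoint]
  · congr 1
    ext c
    simp only [Finset.mem_filter, Finset.mem_union]
    grind
  · rw [Finset.disjoint_filter]
    intro c _
    omega

theorem card_bk_eq (v : ℕ) : (mu.cells.filter fun c => bk T k c.1 c.2 = v).card =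
    (mu.cells.filter fun c => T c.1 c.2 = Equiv.swap k (k + 1) v).card := by
  have h0 : ∀ v, v ≠ k + 1 → (mu.cells.filter fun c => bk T k c.1 c.2 < v).card =
      (mu.cells.filter fun c => T c.1 c.2 < v).card := by
    intro v hv
    simp only [card_lt_eq_sum, cnt_bk T k _ hv]
  have h1 := card_lt_bk T k
  have a0 := h0 k (by omega)
  have a2 := h0 (k + 2) (by omega)
  have b0 := card_eq_add T k
  have b1 := card_eq_add T (k + 1)
  have c0 := card_eq_add (bk T k) k
  have c1 := card_eq_add (bk T k) (k + 1)
  simp only [show k + 1 + 1 = k + 2 from rfl] at b1 c1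
  by_cases hk : v = k
  · subst hk
    rw [Equiv.swap_apply_left]
    omega
  by_cases hk' : v = k + 1
  · subst hk'
    rw [Equiv.swap_apply_right]
    omega
  · rw [Equiv.swap_apply_of_ne_of_ne hk hk']
    have d := card_eq_add T v
    have d' := card_eq_add (bk T k) v
    have := h0 v hk'
    have := h0 (v + 1) (by omega)
    omega

theorem prod_bk {M : Type*} [CommMonoid M] (x : ℕ → M) :
    ∏ c ∈ mu.cells, x (bk T k c.1 c.2) =
      ∏ c ∈ mu.cells, x (Equiv.swap k (k + 1) (T c.1 c.2)) := by
  have : mu.cells.val.map (fun c => bk T k c.1 c.2) =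
      mu.cells.val.map (fun c => Equiv.swap k (k + 1) (T c.1 c.2)) := by
    ext v
    rw [Multiset.count_map, Multiset.count_map]
    have h := card_bk_eq T k v
    simp only [Finset.card, Finset.filter_val] at h
    convert h using 3
    · simp [eq_comm]
    · rw [eq_comm, Equiv.swap_apply_eq_iff]
  have := congrArg (fun s => (Multiset.map x s).prod) this
  simp only [Multiset.map_map] at this
  exact this

end BenderKnuth

theorem rename_var {n k : ℕ} (hk : k + 1 < n) (a : ℕ) :
    rename (Equiv.swap (⟨k, by omega⟩ : Fin n) ⟨k + 1, hk⟩) (var n a) =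
      var n (Equiv.swap k (k + 1) a) := by
  by_cases h1 : a = k
  · subst h1
    rw [Equiv.swap_apply_left, var, var, dif_pos (by omega), dif_pos hk, rename_X,
      Equiv.swap_apply_left]
  by_cases h2 : a = k + 1
  · subst h2
    rw [Equiv.swap_apply_right, var, var, dif_pos (by omega), dif_pos (by omega), rename_X,
      Equiv.swap_apply_right]
  rw [Equiv.swap_apply_of_ne_of_ne h1 h2, var]
  split_ifs with h
  · rw [rename_X, Equiv.swap_apply_of_ne_of_ne] <;> simp [Fin.ext_iff, h1, h2]
  · simp

theorem rename_swap_schurPoly (mu : YoungDiagram) {n k : ℕ} (hk : k + 1 < n) :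
    rename (Equiv.swap (⟨k, by omega⟩ : Fin n) ⟨k + 1, hk⟩) (schurPoly mu n) =
      schurPoly mu n := by
  simp only [schurPoly, map_sum, map_prod, rename_var]
  have hb : ∀ T : BddSSYT mu n, ∀ c ∈ mu.cells, bk T.1 k c.1 c.2 < n := by
    rintro T ⟨i, j⟩ hc
    have := T.2 _ hc
    dsimp only at this ⊢
    rw [bk_apply _ _ (by simpa using hc)]
    split_ifs <;> omega
  refine Fintype.sum_bijective (fun T => (⟨bk T.1 k, hb T⟩ : BddSSYT mu n)) ?_ _ _ ?_
  · refine Function.Involutive.bijective fun T => ?_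
    ext1
    exact bk_bk T.1 k
  · intro T
    exact (prod_bk T.1 k (var n)).symm

theorem schurPoly_isSymmetric (mu : YoungDiagram) (n : ℕ) : (schurPoly mu n).IsSymmetric := by
  cases n with
  | zero =>
    intro e
    rw [Subsingleton.elim e (Equiv.refl _)]
    simp
  | succ n =>
    intro e
    have he : e ∈ Submonoid.closure (Set.range fun i : Fin n ↦ Equiv.swap i.castSucc i.succ) := by
      rw [Equiv.Perm.mclosure_swap_castSucc_succ]
      trivial
    induction he using Submonoid.closure_induction with
    | mem x hx =>
      obtain ⟨i, rfl⟩ := hx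
      exact rename_swap_schurPoly mu (n := n + 1) (k := i) (by omega)
    | one =>
      exact rename_id_apply _
    | mul x y _ _ hx hy =>
      rw [Equiv.Perm.coe_mul, ← rename_rename, hy, hx]

/-- The Schur function `s_λ`. -/
noncomputable def s (lam : Ptn) : SymFun :=
  ⟨fun n => schurPoly lam.diagram n, fun n => schurPoly_isSymmetric _ n,
    fun n => killLast_schurPoly _ n, _, fun n => totalDegree_schurPoly_le _ n⟩

end SymFun
namespace SymFun

/-- The power series `u = t + h₁ t² + h₂ t³ + …`. -/
noncomputable def uSeries : PowerSeries SymFun := PowerSeries.X * PowerSeries.mk h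

/-- The coefficients `h*_k` of the inverse series `t = u + h*₁ u² + h*₂ u³ + …` (with `h*₀ = 1`),
obtained by comparing the coefficients of `t ^ (k + 1)`; see `hStar_spec`. -/
noncomputable def hStar (k : ℕ) : SymFun :=
  (if k = 0 then 1 else 0) -
    ∑ i : Fin k, hStar i * PowerSeries.coeff (k + 1) (uSeries ^ (i.1 + 1))
termination_by k
decreasing_by exact i.2

theorem h_zero : h 0 = 1 := by
  ext1
  funext n
  exact MvPolynomial.hsymm_zero _ _

theorem hStar_spec :
    (PowerSeries.X * PowerSeries.mk hStar).subst uSeries = (PowerSeries.X : PowerSeries SymFun) := by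
  have hU : PowerSeries.HasSubst uSeries :=
    PowerSeries.HasSubst.of_constantCoeff_zero' (by simp [uSeries])
  ext1 n
  rw [PowerSeries.coeff_subst' hU]
  have hz : ∀ d, n < d → PowerSeries.coeff n (uSeries ^ d) = 0 := by
    intro d hd
    rw [uSeries, mul_pow, PowerSeries.coeff_X_pow_mul', if_neg (by omega)]
  rw [finsum_eq_sum_of_support_subset (s := Finset.range (n + 1))]
  · cases n with
    | zero => simp
    | succ n =>
      rw [Finset.sum_range_succ', Finset.sum_range_succ]
      have h1 : PowerSeries.coeff (n + 1) (uSeries ^ (n + 1)) = 1 := by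
        rw [uSeries, mul_pow, PowerSeries.coeff_X_pow_mul', if_pos le_rfl]
        simp [h_zero]
      simp only [PowerSeries.coeff_succ_X_mul, PowerSeries.coeff_mk, smul_eq_mul, h1, mul_one,
        PowerSeries.coeff_zero_X_mul, zero_mul, add_zero]
      rw [hStar, ← Fin.sum_univ_eq_sum_range
        (fun i => hStar i * PowerSeries.coeff (n + 1) (uSeries ^ (i + 1))), PowerSeries.coeff_X]
      simp
  · intro d hd
    by_contra hd'
    simp only [Finset.coe_range, Set.mem_Iio, not_lt] at hd'
    exact hd (by simp [hz d (by omega)])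

/-- `h_λ = h_{λ₁} h_{λ₂} …`. -/
noncomputable def hPart (lam : Ptn) : SymFun := (lam.2.parts.map h).prod

/-- `h*_λ = h*_{λ₁} h*_{λ₂} …`. -/
noncomputable def hStarPart (lam : Ptn) : SymFun := (lam.2.parts.map hStar).prod

/-- `B` is the standard bilinear form on `Λ`, for which `(h_λ)` and `(m_λ)` are dual bases. -/
def IsStandardForm (B : LinearMap.BilinForm ℤ SymFun) : Prop :=
  ∀ lam mu : Ptn, B (hPart lam) (m mu) = if lam = mu then 1 else 0

/-- `ω` is the standard involution of `Λ`, the ring automorphism that switches `e_k` and `h_k`. -/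
def IsStandardInvolution (om : SymFun ≃+* SymFun) : Prop :=
  ∀ k : ℕ, om (e k) = h k ∧ om (h k) = e k

/-- `(g_λ)` is the family dual to `(h*_λ)` with respect to `B`. -/
def IsDualToHStar (B : LinearMap.BilinForm ℤ SymFun) (g : Ptn → SymFun) : Prop :=
  ∀ lam mu : Ptn, B (g lam) (hStarPart mu) = if lam = mu then 1 else 0

end SymFun
section Degree

variable {α : Type*} [Fintype α] [DecidableEq α]

/-- The modified cycle type of a permutation: the parts of its cycle type diminished by `1`
(fixed points contribute nothing). -/
def modType (x : Equiv.Perm α) : Multiset ℕ := x.cycleType.map (· - 1)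

/-- The degree `‖x‖` of a permutation: the size of its modified cycle type. -/
def permDeg (x : Equiv.Perm α) : ℕ := (modType x).sum

/-- The space of functions invariant under a permutation. -/
def invFun (x : Equiv.Perm α) : Submodule ℚ (α → ℚ) where
  carrier := {f | ∀ a, f (x a) = f a}
  add_mem' hf hg a := by simp [hf a, hg a]
  zero_mem' a := rfl
  smul_mem' c f hf a := by simp [hf a]

theorem invFun_sameCycle {x : Equiv.Perm α} {f : α → ℚ} (hf : f ∈ invFun x) {a b : α}
    (h : x.SameCycle a b) : f a = f b := by
  obtain ⟨n, rfl⟩ := h.exists_nat_pow_eq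
  induction n with
  | zero => simp
  | succ n ih =>
    rw [pow_succ', Equiv.Perm.mul_apply, hf]
    exact ih ⟨n, rfl⟩

theorem finrank_invFun_add (x : Equiv.Perm α) :
    Module.finrank ℚ (invFun x) + permDeg x = Fintype.card α := by
  classical
  let I := x.cycleFactorsFinset ⊕ {a // x a = a}
  have hr : ∀ c : x.cycleFactorsFinset, ∃ a, a ∈ c.1.support := fun c => by
    have := (Equiv.Perm.mem_cycleFactorsFinset_iff.1 c.2).1.nonempty_support
    exact this
  choose r0 hr0 using hr
  let r : I → α := Sum.elim r0 (fun a => a.1)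
  let idx : α → I := fun a => if h : x a = a then Sum.inr ⟨a, h⟩ else
    Sum.inl ⟨x.cycleOf a, Equiv.Perm.cycleOf_mem_cycleFactorsFinset_iff.2
      (Equiv.Perm.mem_support.2 h)⟩
  have h1 : ∀ i, idx (r i) = i := by
    rintro (c | ⟨a, ha⟩)
    · have hs := Equiv.Perm.mem_cycleFactorsFinset_support_le c.2 (hr0 c)
      have : x (r0 c) ≠ r0 c := Equiv.Perm.mem_support.1 hs
      simp only [r, Sum.elim_inl, idx, dif_neg this]
      congr 1
      ext1
      exact (Equiv.Perm.cycle_is_cycleOf (hr0 c) c.2).symm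
    · simp [r, idx, ha]
  have h2 : ∀ a, x.SameCycle (r (idx a)) a := by
    intro a
    by_cases ha : x a = a
    · simp only [idx, dif_pos ha, r, Sum.elim_inr]
      exact Equiv.Perm.SameCycle.refl _ _
    · simp only [idx, dif_neg ha, r, Sum.elim_inl]
      have := hr0 ⟨x.cycleOf a, Equiv.Perm.cycleOf_mem_cycleFactorsFinset_iff.2
        (Equiv.Perm.mem_support.2 ha)⟩
      exact ((Equiv.Perm.mem_support_cycleOf_iff' ha).1 this).symm
  have h3 : ∀ a, idx (x a) = idx a := by
    intro a
    by_cases ha : x a = a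
    · rw [ha]
    · have ha' : x (x a) ≠ x a := fun h => ha (x.injective h)
      simp only [idx, dif_neg ha, dif_neg ha']
      congr 1
      ext1
      exact (Equiv.Perm.SameCycle.cycleOf_eq (Equiv.Perm.sameCycle_apply_left.2
        (Equiv.Perm.SameCycle.refl _ _)))
  let L : invFun x ≃ₗ[ℚ] (I → ℚ) :=
    { toFun := fun f i => f.1 (r i)
      map_add' := fun _ _ => rfl
      map_smul' := fun _ _ => rfl
      invFun := fun g => ⟨fun a => g (idx a), fun a => congrArg g (h3 a)⟩
      left_inv := fun f => by
        ext a
        exact invFun_sameCycle f.2 (h2 a)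
      right_inv := fun g => by
        funext i
        simp [h1] }
  rw [L.finrank_eq, Module.finrank_fintype_fun_eq_card, Fintype.card_sum]
  have h4 : Fintype.card {a // x a = a} + x.support.card = Fintype.card α := by
    rw [Fintype.card_subtype, ← Finset.card_univ]
    have := Finset.card_filter_add_card_filter_not (s := (Finset.univ : Finset α))
      (fun a => x a = a)
    simpa [Equiv.Perm.support] using this
  have h5 : permDeg x + x.cycleFactorsFinset.card = x.support.card := by
    rw [← Equiv.Perm.sum_cycleType, permDeg, modType]
    have h6 : x.cycleType.card = x.cycleFactorsFinset.card := by
      rw [Equiv.Perm.cycleType_def]; simp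
    rw [← h6]
    have h7 : ∀ s : Multiset ℕ, (∀ a ∈ s, 2 ≤ a) → (s.map (· - 1)).sum + s.card = s.sum := by
      intro s
      induction s using Multiset.induction_on with
      | empty => simp
      | cons a s ih =>
        intro hs
        have h8 := ih fun b hb => hs b (Multiset.mem_cons_of_mem hb)
        have h9 := hs a (Multiset.mem_cons_self a s)
        simp only [Multiset.map_cons, Multiset.sum_cons, Multiset.card_cons]
        omega
    exact h7 _ fun a ha => Equiv.Perm.two_le_of_mem_cycleType ha
  simp only [Fintype.card_coe]
  omega

theorem invFun_inf_le (x y : Equiv.Perm α) : invFun x ⊓ invFun y ≤ invFun (x * y) := by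
  rintro f ⟨hx, hy⟩ a
  rw [Equiv.Perm.mul_apply, hx, hy]

theorem permDeg_mul_le (x y : Equiv.Perm α) : permDeg (x * y) ≤ permDeg x + permDeg y := by
  have h1 := Submodule.finrank_sup_add_finrank_inf_eq (invFun x) (invFun y)
  have h2 := Submodule.finrank_mono (invFun_inf_le x y)
  have h3 := Submodule.finrank_le (invFun x ⊔ invFun y)
  rw [Module.finrank_fintype_fun_eq_card] at h3
  have h4 := finrank_invFun_add x
  have h5 := finrank_invFun_add y
  have h6 := finrank_invFun_add (x * y)
  omega

theorem fixed_of_permDeg_mul {x y : Equiv.Perm α} (h : permDeg x + permDeg y = permDeg (x * y))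
    {a : α} (ha : (x * y) a = a) : y a = a := by
  have h1 := Submodule.finrank_sup_add_finrank_inf_eq (invFun x) (invFun y)
  have h3 := Submodule.finrank_le (invFun x ⊔ invFun y)
  rw [Module.finrank_fintype_fun_eq_card] at h3
  have h4 := finrank_invFun_add x
  have h5 := finrank_invFun_add y
  have h6 := finrank_invFun_add (x * y)
  have h7 := Submodule.eq_of_le_of_finrank_le (invFun_inf_le x y) (by omega)
  have h8 : (Pi.single a 1 : α → ℚ) ∈ invFun (x * y) := by
    intro b
    by_cases hb : b = a
    · rw [hb, ha]
    · have : (x * y) b ≠ a := fun h => hb ((x * y).injective (h.trans ha.symm))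
      rw [Pi.single_apply, Pi.single_apply, if_neg this, if_neg hb]
  rw [← h7] at h8
  have := h8.2 a
  by_contra hne
  simp [hne] at this

theorem modType_conj (x g : Equiv.Perm α) : modType (g * x * g⁻¹) = modType x := by
  rw [modType, Equiv.Perm.cycleType_conj, modType]

theorem permDeg_conj (x g : Equiv.Perm α) : permDeg (g * x * g⁻¹) = permDeg x := by
  rw [permDeg, modType_conj, permDeg]

theorem permDeg_one : permDeg (1 : Equiv.Perm α) = 0 := by
  simp [permDeg, modType]

theorem permDeg_mul_comm (x y : Equiv.Perm α) : permDeg (x * y) = permDeg (y * x) := by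
  have := permDeg_conj (x * y) y
  rwa [← mul_assoc, mul_inv_cancel_right, eq_comm] at this

theorem modType_extend {β : Type*} [Fintype β] [DecidableEq β] (f : α ↪ β) (x : Equiv.Perm α) :
    modType (x.viaFintypeEmbedding f) = modType x := by
  rw [modType, Equiv.Perm.viaFintypeEmbedding, Equiv.Perm.cycleType_extendDomain, modType]

theorem permDeg_extend {β : Type*} [Fintype β] [DecidableEq β] (f : α ↪ β) (x : Equiv.Perm α) :
    permDeg (x.viaFintypeEmbedding f) = permDeg x := by
  rw [permDeg, modType_extend, permDeg]

end Degree

/-- The graded ring associated to the group ring `ℤ[S_n]` filtered by the degree of permutations.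
As an abelian group it is `ℤ[S_n]` (integer functions on `S_n`). The product `⋆` of two
permutations `y`, `z` is `yz` if `‖yz‖ = ‖y‖ + ‖z‖`, and `0` otherwise. -/
def GrGroupRing (n : ℕ) : Type := Equiv.Perm (Fin n) → ℤ

namespace GrGroupRing

variable {n : ℕ}

instance : AddCommGroup (GrGroupRing n) := inferInstanceAs (AddCommGroup (Equiv.Perm (Fin n) → ℤ))

/-- The coefficient of `x` in `f ⋆ g` is the sum of `f(y) g(z)` over the factorizations `x = y z`
with `‖x‖ = ‖y‖ + ‖z‖`. -/
instance : Mul (GrGroupRing n) where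
  mul f g := fun x => ∑ y : Equiv.Perm (Fin n),
    if permDeg y + permDeg (y⁻¹ * x) = permDeg x then f y * g (y⁻¹ * x) else 0

/-- The element of the graded group ring given by a permutation. -/
def of (x : Equiv.Perm (Fin n)) : GrGroupRing n := Pi.single x (1 : ℤ)

instance : One (GrGroupRing n) := ⟨of 1⟩

theorem mul_apply (f g : GrGroupRing n) (x : Equiv.Perm (Fin n)) : (f * g) x =
    ∑ y, if permDeg y + permDeg (y⁻¹ * x) = permDeg x then f y * g (y⁻¹ * x) else 0 := rfl

theorem of_apply (x y : Equiv.Perm (Fin n)) : of x y = if y = x then 1 else 0 :=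
  Pi.single_apply x 1 y

theorem one_apply (y : Equiv.Perm (Fin n)) : (1 : GrGroupRing n) y = if y = 1 then 1 else 0 :=
  of_apply 1 y

theorem add_apply (f g : GrGroupRing n) (x : Equiv.Perm (Fin n)) : (f + g) x = f x + g x := rfl

theorem neg_apply (f : GrGroupRing n) (x : Equiv.Perm (Fin n)) : (-f) x = -f x := rfl

theorem zero_apply (x : Equiv.Perm (Fin n)) : (0 : GrGroupRing n) x = 0 := rfl

theorem sum_apply {ι : Type*} (s : Finset ι) (f : ι → GrGroupRing n) (x : Equiv.Perm (Fin n)) :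
    (∑ i ∈ s, f i) x = ∑ i ∈ s, f i x := Finset.sum_apply x s f

@[ext]
theorem ext {f g : GrGroupRing n} (h : ∀ x, f x = g x) : f = g := funext h

protected theorem mul_assoc (f g h : GrGroupRing n) : f * g * h = f * (g * h) := by
  ext x
  simp only [mul_apply, Finset.sum_mul, Finset.mul_sum, ite_mul, mul_ite, zero_mul, mul_zero,
    Finset.ite_sum_zero]
  rw [Finset.sum_comm]
  refine Finset.sum_congr rfl fun z _ => ?_
  rw [← Equiv.sum_comp (Equiv.mulLeft z)]
  refine Finset.sum_congr rfl fun w _ => ?_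
  simp only [Equiv.coe_mulLeft, mul_inv_rev, inv_mul_cancel_left, mul_assoc, ← ite_and]
  have h1 := permDeg_mul_le z w
  have h2 := permDeg_mul_le z (z⁻¹ * x)
  have h3 := permDeg_mul_le w (w⁻¹ * (z⁻¹ * x))
  have h4 := permDeg_mul_le (z * w) (w⁻¹ * (z⁻¹ * x))
  simp only [mul_inv_cancel_left, mul_assoc] at h2 h3 h4
  exact if_congr (by omega) rfl rfl

instance : Ring (GrGroupRing n) where
  __ := (inferInstance : AddCommGroup (GrGroupRing n))
  mul_assoc := GrGroupRing.mul_assoc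
  one_mul f := by
    ext x
    rw [mul_apply, Finset.sum_eq_single 1]
    · simp [permDeg_one, one_apply]
    · intro y _ hy
      simp [one_apply, hy]
    · simp
  mul_one f := by
    ext x
    rw [mul_apply, Finset.sum_eq_single x]
    · simp [permDeg_one, one_apply]
    · intro y _ hy
      have : y⁻¹ * x ≠ 1 := fun h => hy (inv_mul_eq_one.1 h)
      simp [one_apply, this]
    · simp
  left_distrib f g h := by
    ext x
    simp only [mul_apply, add_apply, ← Finset.sum_add_distrib]
    refine Finset.sum_congr rfl fun y _ => ?_
    split_ifs <;> ring
  right_distrib f g h := by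
    ext x
    simp only [mul_apply, add_apply, ← Finset.sum_add_distrib]
    refine Finset.sum_congr rfl fun y _ => ?_
    split_ifs <;> ring
  zero_mul f := by
    ext x
    simp [mul_apply, zero_apply]
  mul_zero f := by
    ext x
    simp [mul_apply, zero_apply]

/-- The product of two permutations in the graded group ring. -/
theorem of_mul_of (y z : Equiv.Perm (Fin n)) :
    of y * of z = if permDeg y + permDeg z = permDeg (y * z) then of (y * z) else 0 := by
  ext x
  rw [mul_apply, Finset.sum_eq_single y]
  · by_cases hx : x = y * z
    · subst hx
      split_ifs with h1 h2 h2 <;> simp_all [of_apply, zero_apply]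
    · have h : y⁻¹ * x ≠ z := fun h => hx (by rw [← h, mul_inv_cancel_left])
      split_ifs <;> simp [of_apply, zero_apply, hx, h]
  · intro w _ hw
    simp [of_apply, hw]
  · simp

/-- The Jucys–Murphy element `ξ_j = ∑_{i < j} (i, j)`. -/
def jm (j : Fin n) : GrGroupRing n := ∑ i ∈ Finset.Iio j, of (Equiv.swap i j)

/-- `(-Ξ)^{⋆k}(n) = ∑_j (-1)^k ξ_j ⋆ ⋯ ⋆ ξ_j` (`k` factors). -/
def negJMPower (n k : ℕ) : GrGroupRing n := ∑ j : Fin n, (-1) ^ k * jm j ^ k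

theorem of_commute_jm (x : Equiv.Perm (Fin n)) (j : Fin n) (hx : ∀ i, j ≤ i → x i = i) :
    Commute (of x) (jm j) := by
  have hlt : ∀ i, i < j → x i < j := by
    intro i hi
    by_contra h
    push Not at h
    have := x.injective (hx _ h)
    rw [this] at h
    exact absurd hi (not_lt.2 h)
  have hlt' : ∀ i, i < j → x⁻¹ i < j := by
    intro i hi
    by_contra h
    push Not at h
    have := hx _ h
    rw [Equiv.Perm.inv_def, Equiv.apply_symm_apply] at this
    rw [Equiv.Perm.inv_def, ← this] at h
    exact absurd hi (not_lt.2 h)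
  rw [Commute, SemiconjBy, jm, Finset.mul_sum, Finset.sum_mul]
  refine Finset.sum_nbij' (fun i => x i) (fun i => x⁻¹ i) ?_ ?_ ?_ ?_ ?_
  · intro i hi
    simpa using hlt i (by simpa using hi)
  · intro i hi
    exact Finset.mem_Iio.2 (hlt' i (Finset.mem_Iio.1 hi))
  · intro i _
    simp
  · intro i _
    simp
  · intro i _
    have hs : Equiv.swap (x i) j = x * Equiv.swap i j * x⁻¹ := by
      rw [← Equiv.swap_apply_apply, hx j le_rfl]
    rw [of_mul_of, of_mul_of, hs, inv_mul_cancel_right, permDeg_conj, add_comm]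

/-- The Jucys–Murphy elements commute. -/
theorem jm_commute (i j : Fin n) : Commute (jm i) (jm j) := by
  wlog hij : i < j generalizing i j
  · rcases (not_lt.1 hij).lt_or_eq with h | h
    · exact (this j i h).symm
    · rw [h]
  · refine Commute.sum_left _ _ _ fun a ha => of_commute_jm _ _ fun b hb => ?_
    have ha' : a < i := by simpa using ha
    exact Equiv.swap_apply_of_ne_of_ne (by omega) (by omega)

end GrGroupRing

open scoped IsMulCommutative in
/-- Evaluation of a polynomial with integer coefficients at pairwise commuting elements of a ring
(inside the commutative subring that they generate). -/
noncomputable def evalCommuting {A ι : Type*} [Ring A] (a : ι → A)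
    (ha : ∀ i j, Commute (a i) (a j)) : MvPolynomial ι ℤ →+* A :=
  haveI : IsMulCommutative (Algebra.adjoin ℤ (Set.range a)) :=
    Algebra.isMulCommutative_adjoin ℤ (by
      rintro _ ⟨i, rfl⟩ _ ⟨j, rfl⟩
      exact ha i j)
  (Algebra.adjoin ℤ (Set.range a)).val.toRingHom.comp
    (MvPolynomial.aeval (R := ℤ)
      (fun i => (⟨a i, Algebra.subset_adjoin ⟨i, rfl⟩⟩ : Algebra.adjoin ℤ (Set.range a)))).toRingHom

open scoped IsMulCommutative in
theorem evalCommuting_X {A ι : Type*} [Ring A] (a : ι → A)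
    (ha : ∀ i j, Commute (a i) (a j)) (i : ι) : evalCommuting a ha (MvPolynomial.X i) = a i := by
  simp [evalCommuting]

/-- The value `f(-ξ₁, …, -ξₙ)` of a symmetric function `f` at the negated Jucys–Murphy elements,
computed with the product of the graded group ring. -/
noncomputable def jmEval (n : ℕ) (f : SymFun) : GrGroupRing n :=
  evalCommuting (fun j => -GrGroupRing.jm j)
    (fun i j => ((GrGroupRing.jm_commute i j).neg_left).neg_right) (f.1 n)

/-- The ring `𝒢(n)`, the graded ring associated to the filtered ring of integer class functions
on `S_n`: the class functions inside the graded group ring. -/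
def GrClass (n : ℕ) : Subring (GrGroupRing n) where
  carrier := {f | ∀ g x : Equiv.Perm (Fin n), f (g * x * g⁻¹) = f x}
  mul_mem' := by
    intro f f' hf hf' g x
    rw [GrGroupRing.mul_apply, GrGroupRing.mul_apply, ← Equiv.sum_comp (MulAut.conj g).toEquiv]
    refine Finset.sum_congr rfl fun y _ => ?_
    have h : (g * y * g⁻¹)⁻¹ * (g * x * g⁻¹) = g * (y⁻¹ * x) * g⁻¹ := by group
    simp only [MulEquiv.toEquiv_eq_coe, MulEquiv.coe_toEquiv, MulAut.conj_apply, h, permDeg_conj,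
      hf g y, hf' g (y⁻¹ * x)]
  one_mem' := by
    intro g x
    simp [GrGroupRing.one_apply]
  add_mem' := by
    intro f f' hf hf' g x
    rw [GrGroupRing.add_apply, GrGroupRing.add_apply, hf, hf']
  zero_mem' := fun _ _ => rfl
  neg_mem' := by
    intro f hf g x
    rw [GrGroupRing.neg_apply, GrGroupRing.neg_apply, hf]

/-- `K_λ(n)`: the sum of the permutations in `S_n` of modified cycle type `λ`. -/
def classSum (lam : Ptn) (n : ℕ) : GrClass n :=
  ⟨fun x => if modType x = lam.2.parts then 1 else 0, fun g x => by
    simp only [modType_conj]⟩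

/-- The natural embedding of `S_n` into `S_{n+1}`. -/
def permSucc {n : ℕ} (x : Equiv.Perm (Fin n)) : Equiv.Perm (Fin (n + 1)) :=
  x.viaFintypeEmbedding Fin.castSuccEmb

theorem permSucc_castSucc {n : ℕ} (x : Equiv.Perm (Fin n)) (i : Fin n) :
    permSucc x i.castSucc = (x i).castSucc :=
  x.viaFintypeEmbedding_apply_image Fin.castSuccEmb i

theorem permSucc_last {n : ℕ} (x : Equiv.Perm (Fin n)) : permSucc x (Fin.last n) = Fin.last n :=
  x.viaFintypeEmbedding_apply_notMem_range Fin.castSuccEmb (by simp)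

theorem permSucc_mul {n : ℕ} (x y : Equiv.Perm (Fin n)) :
    permSucc (x * y) = permSucc x * permSucc y := by
  ext1 i
  induction i using Fin.lastCases with
  | last => simp [permSucc_last]
  | cast i => simp [permSucc_castSucc]

theorem permSucc_one {n : ℕ} : permSucc (1 : Equiv.Perm (Fin n)) = 1 := by
  ext1 i
  induction i using Fin.lastCases with
  | last => simp [permSucc_last]
  | cast i => simp [permSucc_castSucc]

theorem permSucc_inv {n : ℕ} (x : Equiv.Perm (Fin n)) : permSucc x⁻¹ = (permSucc x)⁻¹ := by
  rw [eq_inv_iff_mul_eq_one, ← permSucc_mul, inv_mul_cancel, permSucc_one]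

theorem permSucc_injective {n : ℕ} :
    Function.Injective (permSucc : Equiv.Perm (Fin n) → Equiv.Perm (Fin (n + 1))) := by
  intro x y h
  ext1 i
  have := congrArg (fun z => z i.castSucc) h
  simpa [permSucc_castSucc] using this

theorem exists_permSucc {n : ℕ} (y : Equiv.Perm (Fin (n + 1))) (hy : y (Fin.last n) = Fin.last n) :
    ∃ x : Equiv.Perm (Fin n), permSucc x = y := by
  have h : ∀ z : Equiv.Perm (Fin (n + 1)), z (Fin.last n) = Fin.last n → ∀ i : Fin n,
      ∃ j : Fin n, j.castSucc = z i.castSucc := by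
    intro z hz i
    refine Fin.exists_castSucc_eq.2 fun h => ?_
    exact (Fin.castSucc_lt_last i).ne (z.injective (h.trans hz.symm))
  choose f hf using h y hy
  choose f' hf' using h y⁻¹ (by rw [Equiv.Perm.inv_eq_iff_eq, hy])
  refine ⟨⟨f, f', fun i => ?_, fun i => ?_⟩, ?_⟩
  · apply Fin.castSucc_injective
    rw [hf', hf, Equiv.Perm.inv_def, Equiv.symm_apply_apply]
  · apply Fin.castSucc_injective
    rw [hf, hf', Equiv.Perm.inv_def, Equiv.apply_symm_apply]
  · ext1 i
    induction i using Fin.lastCases with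
    | last => rw [permSucc_last, hy]
    | cast i =>
      rw [permSucc_castSucc]
      exact hf i

/-- Restriction of functions from `S_{n+1}` to `S_n`. -/
def restrict {n : ℕ} (f : GrGroupRing (n + 1)) : GrGroupRing n := fun x => f (permSucc x)

theorem restrict_mul {n : ℕ} (f g : GrGroupRing (n + 1)) :
    restrict (f * g) = restrict f * restrict g := by
  ext x
  rw [restrict, GrGroupRing.mul_apply, GrGroupRing.mul_apply]
  symm
  refine Finset.sum_of_injOn permSucc permSucc_injective.injOn (by simp) ?_ ?_
  · intro y _ hy
    refine if_neg fun h => hy ?_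
    have h1 : (y * (y⁻¹ * permSucc x)) (Fin.last n) = Fin.last n := by
      rw [mul_inv_cancel_left, permSucc_last]
    have h2 := fixed_of_permDeg_mul (by rw [mul_inv_cancel_left, h]) h1
    rw [Equiv.Perm.mul_apply, permSucc_last, Equiv.Perm.inv_eq_iff_eq] at h2
    obtain ⟨z, hz⟩ := exists_permSucc y h2.symm
    exact ⟨z, by simp, hz⟩
  · intro y _
    rw [← permSucc_inv, ← permSucc_mul]
    simp only [restrict, permSucc, permDeg_extend]

/-- The Farahat–Higman ring `𝒢`, as the inverse limit, in the category of graded rings, of the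
rings `𝒢(n)` under restriction of functions: its elements are the families of elements of `𝒢(n)`
that are compatible with restriction and whose supports have bounded degree. -/
def FHRing : Subring (∀ n : ℕ, GrClass n) where
  carrier := {f | (∀ n : ℕ, restrict (f (n + 1)).1 = (f n).1) ∧
    ∃ N : ℕ, ∀ (n : ℕ) (x : Equiv.Perm (Fin n)), (f n).1 x ≠ 0 → permDeg x ≤ N}
  mul_mem' := by
    rintro f g ⟨hf, N, hN⟩ ⟨hg, M, hM⟩
    refine ⟨fun n => ?_, N + M, fun n x hx => ?_⟩
    · change restrict ((f (n + 1)).1 * (g (n + 1)).1) = (f n).1 * (g n).1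
      rw [restrict_mul, hf, hg]
    · change ((f n).1 * (g n).1) x ≠ 0 at hx
      rw [GrGroupRing.mul_apply] at hx
      obtain ⟨y, -, hy⟩ := Finset.exists_ne_zero_of_sum_ne_zero hx
      split_ifs at hy with h
      · have h1 := hN n y (left_ne_zero_of_mul hy)
        have h2 := hM n _ (right_ne_zero_of_mul hy)
        omega
      · exact absurd rfl hy
  one_mem' := by
    refine ⟨fun n => ?_, 0, fun n x hx => ?_⟩
    · ext x
      change (1 : GrGroupRing (n + 1)) (permSucc x) = (1 : GrGroupRing n) x
      rw [GrGroupRing.one_apply, GrGroupRing.one_apply]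
      refine if_congr ?_ rfl rfl
      rw [← permSucc_one (n := n), permSucc_injective.eq_iff]
    · change (1 : GrGroupRing n) x ≠ 0 at hx
      rw [GrGroupRing.one_apply] at hx
      split_ifs at hx with h
      · rw [h, permDeg_one]
      · exact absurd rfl hx
  add_mem' := by
    rintro f g ⟨hf, N, hN⟩ ⟨hg, M, hM⟩
    refine ⟨fun n => ?_, max N M, fun n x hx => ?_⟩
    · change restrict (f (n + 1)).1 + restrict (g (n + 1)).1 = (f n).1 + (g n).1
      rw [hf, hg]
    · change (f n).1 x + (g n).1 x ≠ 0 at hx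
      by_cases h : (f n).1 x = 0
      · rw [h, zero_add] at hx
        exact (hM n x hx).trans (le_max_right _ _)
      · exact (hN n x h).trans (le_max_left _ _)
  zero_mem' := ⟨fun _ => rfl, 0, fun _ _ hx => absurd rfl hx⟩
  neg_mem' := by
    rintro f ⟨hf, N, hN⟩
    refine ⟨fun n => ?_, N, fun n x hx => hN n x ?_⟩
    · change -restrict (f (n + 1)).1 = -(f n).1
      rw [hf]
    · change -(f n).1 x ≠ 0 at hx
      exact neg_ne_zero.1 hx

namespace FHRing

/-- The stable class sum `K_λ`. -/
def K (lam : Ptn) : FHRing :=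
  ⟨fun n => classSum lam n, fun n => by
    ext x
    simp only [classSum, restrict, permSucc, modType_extend], lam.1, fun n x hx => by
    simp only [classSum] at hx
    rw [permDeg, (ite_ne_right_iff.1 hx).1, lam.2.parts_sum]⟩

/-- The natural ring homomorphism from `𝒢` to `𝒢(n)`, with values viewed in the graded group ring
of `S_n`. -/
def proj (n : ℕ) : FHRing →+* GrGroupRing n :=
  (GrClass n).subtype.comp ((Pi.evalRingHom _ n).comp FHRing.subtype)

end FHRing

/-! The isomorphism is the inverse of evaluation `f ↦ f(-Ξ)`, twisted by `ω`. Everything rests on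
one formula (`IsStandardForm.jmHom_omegaHom`): the coefficient of a permutation `x` of modified type
`λ` in `(ωf)(-Ξ_n)` is `⟨f, h*_λ⟩`. The right side depends on `λ` only and vanishes for large `|λ|`,
so the values `f(-Ξ_n)` are the components of an element of `𝒢`. Evaluation `Λ → 𝒢` is injective
because the form is nondegenerate and `(h*_λ)` is a basis. For `f = g_λ` the formula says that `ω
g_λ` is sent to `K_λ`, and the `K_λ` span `𝒢`, so evaluation is onto. Hence `φ` must be `ω` after
the inverse of evaluation, and `ωφ(f(-Ξ)) = f` for every `f`; the four families are the cases `f =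
p_k, e_k, h_k, s_λ`.

By linearity take `f = h_μ`: the coefficient of `x` in `e_μ(-Ξ_n)` has to be the coefficient of
`m_μ` in `h*_λ`. All `μ` are packed into `∏_{i,j} (1 - t_i ξ_j) = ∏_j ∑_k (-1)^k e_k(t) ξ_j^k`,
whose coefficient at `x` is shown to be the product of `h*_{c-1}(t)` over the cycles of `x`, `c`
being the length (`jmHom_prod_e`).

That product is built up one `j` at a time. In the graded product a transposition `(b j)`
contributes only when it joins two cycles. So a permutation fixing all points after `j` arises from
`ξ_j^k` and one that also fixes `j` by cutting its cycle through `j` into `j` alone and `k` nonempty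
arcs (`jm_pow_mul_apply`). For a multiplicative weight `g`, with `F = ∑ g_m z^(m+1)`, summing over
the cuts gives coefficients of `F^k`. The weight therefore reproduces itself if `F = z ∑ (-1)^k
e_k(t) F^k = z E(-F) = z / H(F)`, that is `F H(F) = z`. This says that `F` inverts `u = t H(t)`, so
`g_m = h*_m(t)` (`hStar_eq_sum`). -/

/-! ### Cycles cut by transpositions, and multiplicative weights on permutations -/

namespace List

variable {α : Type*} [DecidableEq α]

/-- Multiplying on the left by `(a b)` cuts a cycle through `a` and `b` into two arcs. The induction
removes the points between them, carrying `(a b)` past one transposition at a time. -/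
theorem formPerm_cons_append_cons (a b : α) (A B : List α)
    (hd : ((a :: A) ++ b :: B).Nodup) :
    formPerm ((a :: A) ++ b :: B) =
      Equiv.swap a b * (formPerm (a :: A) * formPerm (b :: B)) := by
  induction A generalizing a with
  | nil => simp [formPerm_cons_cons]
  | cons c A ih =>
    have hd' : ((c :: A) ++ b :: B).Nodup := (nodup_cons.1 hd).2
    have h1 : a ≠ c := by
      rintro rfl
      simp at hd
    have h2 : a ≠ b := by
      rintro rfl
      simp at hd
    have h3 : c ≠ b := by
      rintro rfl
      simp at hd'
    have hs : Equiv.swap a c * Equiv.swap c b = Equiv.swap a b * Equiv.swap a c := by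
      rw [Equiv.mul_swap_eq_swap_mul, Equiv.swap_apply_right, Equiv.swap_apply_of_ne_of_ne h2.symm h3.symm]
    rw [cons_append, cons_append, formPerm_cons_cons, ← cons_append, ih c hd', formPerm_cons_cons,
      ← mul_assoc, hs]
    simp only [mul_assoc]

end List

namespace Equiv.Perm

variable {α : Type*} [Fintype α] [DecidableEq α]

/-- Every permutation is the product of the cycle through a given point and a permutation fixing
that cycle pointwise. -/
theorem exists_formPerm_mul (x : Perm α) (a : α) : ∃ (A : List α) (r : Perm α),
    (a :: A).Nodup ∧ (∀ b ∈ a :: A, r b = b) ∧ x = (a :: A).formPerm * r := by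
  by_cases ha : x a = a
  · exact ⟨[], x, by simp, by simpa using ha, by simp⟩
  · have ha' := mem_support.2 ha
    have hl := length_toList_pos_of_mem_support x a ha'
    have h0 : (toList x a)[0]? = some a :=
      List.getElem?_eq_some_iff.2 ⟨hl, toList_getElem_zero x a ha'⟩
    have hf := formPerm_toList x a
    have hn := nodup_toList x a
    have hm : ∀ b ∈ toList x a, x.SameCycle a b := fun b hb => (mem_toList_iff.1 hb).1
    generalize toList x a = L at *
    match L, hl with
    | c :: A, _ =>
      simp only [List.length_cons, Nat.zero_lt_succ, getElem?_pos, List.getElem_cons_zero, Option.some.injEq] at h0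
      subst h0
      -- Removing the cycle from `x` leaves a factor that is the identity on that cycle.
      refine ⟨A, (x.cycleOf c)⁻¹ * x, hn, fun b hb => ?_, ?_⟩
      · rw [mul_apply, inv_eq_iff_eq, (hm b hb).cycleOf_apply]
      · rw [hf, mul_inv_cancel_left]

end Equiv.Perm

section CycleWeight

open Equiv Equiv.Perm

variable {α : Type*} [Fintype α] [DecidableEq α]

theorem disjoint_formPerm {L : List α} {r : Perm α} (hr : ∀ b ∈ L, r b = b) :
    L.formPerm.Disjoint r := by
  intro b
  by_cases hb : b ∈ L
  · exact Or.inr (hr b hb)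
  · exact Or.inl (List.formPerm_apply_of_notMem hb)

/-- The two factors are disjoint, so their types add. The case distinction is needed because a
one-point list is a fixed point, which the modified type does not record. -/
theorem modType_formPerm_mul {a : α} {A : List α} {r : Perm α} (hd : (a :: A).Nodup)
    (hr : ∀ b ∈ a :: A, r b = b) :
    modType ((a :: A).formPerm * r) = (if A.length = 0 then 0 else {A.length}) + modType r := by
  rw [modType, (disjoint_formPerm hr).cycleType_mul, Multiset.map_add, modType]
  congr 1
  by_cases hA : A.length = 0
  · rw [if_pos hA, List.length_eq_zero_iff.1 hA]
    simp
  · have hc := List.isCycle_formPerm hd (by simp only [List.length_cons]; omega)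
    rw [if_neg hA, hc.cycleType, List.support_formPerm_of_nodup _ hd, List.toFinset_card_of_nodup hd]
    · simp
    · intro c hc
      simp only [List.cons.injEq] at hc
      simp [hc.2] at hA

theorem permDeg_formPerm_mul {a : α} {A : List α} {r : Perm α} (hd : (a :: A).Nodup)
    (hr : ∀ b ∈ a :: A, r b = b) :
    permDeg ((a :: A).formPerm * r) = A.length + permDeg r := by
  rw [permDeg, modType_formPerm_mul hd hr, Multiset.sum_add, permDeg]
  split_ifs with h <;> simp [h]

/-- The multiplicative function on permutations with value `g k` on cycles of length `k + 1`. -/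
def cycleWeight {R : Type*} [CommMonoid R] (g : ℕ → R) (x : Perm α) : R :=
  ((modType x).map g).prod

/-- The condition `g 0 = 1` lets fixed points count as cycles of length one, so the cycle through a
given point needs no case distinction. -/
theorem cycleWeight_formPerm_mul {R : Type*} [CommMonoid R] {g : ℕ → R} (hg : g 0 = 1) {a : α}
    {A : List α} {r : Perm α} (hd : (a :: A).Nodup) (hr : ∀ b ∈ a :: A, r b = b) :
    cycleWeight g ((a :: A).formPerm * r) = g A.length * cycleWeight g r := by
  rw [cycleWeight, modType_formPerm_mul hd hr, Multiset.map_add, Multiset.prod_add, cycleWeight]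
  split_ifs with h
  · simp [h, hg]
  · simp

theorem cycleWeight_one {R : Type*} [CommMonoid R] (g : ℕ → R) :
    cycleWeight g (1 : Perm α) = 1 := by
  simp [cycleWeight, modType]

theorem permDeg_swap {a b : α} (h : a ≠ b) : permDeg (swap a b) = 1 := by
  rw [permDeg, modType, (isCycle_swap h).cycleType, card_support_swap h]
  simp

/-- If multiplication by a transposition lowers the degree, then the transposition exchanges two
elements of the same cycle. -/
theorem mem_of_permDeg_swap_mul {a b : α} {A : List α} {r : Perm α}
    (hr : ∀ c ∈ a :: A, r c = c) (hab : b ≠ a)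
    (h : permDeg (swap b a * ((a :: A).formPerm * r)) + 1 = permDeg ((a :: A).formPerm * r)) :
    b ∈ A := by
  set x := (a :: A).formPerm * r with hx
  have hx' : swap b a * (swap b a * x) = x := by rw [← mul_assoc, swap_mul_self, one_mul]
  have h1 := Submodule.finrank_sup_add_finrank_inf_eq (invFun (swap b a)) (invFun (swap b a * x))
  have h3 := Submodule.finrank_le (invFun (swap b a) ⊔ invFun (swap b a * x))
  rw [Module.finrank_fintype_fun_eq_card] at h3
  have h4 := finrank_invFun_add (swap b a)
  have h5 := finrank_invFun_add (swap b a * x)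
  have h6 := finrank_invFun_add x
  rw [permDeg_swap hab] at h4
  have h0 := invFun_inf_le (swap b a) (swap b a * x)
  rw [hx'] at h0
  -- The drop in degree forces, by dimension, the invariants of `x` to be exactly the common
  -- invariants of `(b a)` and `(b a) x`.
  have h7 := Submodule.eq_of_le_of_finrank_le h0 (by omega)
  -- The indicator of the cycle through `a` is invariant under `x`, hence under `(b a)`; its value
  -- at `b` is then `1`.
  have hf : (fun c => if c ∈ a :: A then (1 : ℚ) else 0) ∈ invFun x := by
    intro c
    dsimp only
    by_cases hc : c ∈ a :: A
    · rw [hx, mul_apply, hr c hc, if_pos hc, if_pos (List.formPerm_apply_mem_of_mem hc)]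
    · have : x c ∉ a :: A := by
        rw [hx, mul_apply]
        intro h8
        have h9 := List.mem_of_formPerm_apply_mem h8
        have h10 := hr _ h9
        rw [r.injective h10] at h9
        exact hc h9
      rw [if_neg hc, if_neg this]
  rw [← h7] at hf
  have h8 := hf.1 a
  dsimp only at h8
  rw [swap_apply_right, if_pos List.mem_cons_self] at h8
  have h9 : b ∈ a :: A := by
    by_contra hb
    rw [if_neg hb] at h8
    norm_num at h8
  exact (List.mem_cons.1 h9).resolve_left hab

end CycleWeight

/-! ### Products with powers of Jucys–Murphy elements -/

namespace GrGroupRing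

open Equiv Equiv.Perm

variable {n : ℕ}

theorem of_mul_apply (y : Perm (Fin n)) (V : GrGroupRing n) (x : Perm (Fin n)) :
    (of y * V) x = if permDeg y + permDeg (y⁻¹ * x) = permDeg x then V (y⁻¹ * x) else 0 := by
  rw [mul_apply, Finset.sum_eq_single y]
  · simp [of_apply]
  · intro z _ hz
    simp [of_apply, hz]
  · simp

theorem jm_mul_apply (j : Fin n) (V : GrGroupRing n) (x : Perm (Fin n)) :
    (jm j * V) x = ∑ b ∈ Finset.Iio j,
      if permDeg (swap b j * x) + 1 = permDeg x then V (swap b j * x) else 0 := by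
  rw [jm, Finset.sum_mul, sum_apply]
  refine Finset.sum_congr rfl fun b hb => ?_
  rw [of_mul_apply, permDeg_swap (Finset.mem_Iio.1 hb).ne, swap_inv, add_comm]

open PowerSeries in
/-- Multiplying the multiplicative function of weight `g`, restricted to permutations that fix all
points from `j` on, by a power of the Jucys–Murphy element `ξ_j`. -/
theorem jm_pow_mul_apply (g : ℕ → ℤ) (hg : g 0 = 1) (j : Fin n) (Y : GrGroupRing n)
    (hY : ∀ x, Y x = if ∀ i, j ≤ i → x i = i then cycleWeight g x else 0) (k : ℕ) :
    (∀ x : Perm (Fin n), (¬ ∀ i, j < i → x i = i) → (jm j ^ k * Y) x = 0) ∧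
    ∀ (A : List (Fin n)) (r : Perm (Fin n)), (j :: A).Nodup → (∀ b ∈ j :: A, r b = b) →
      (∀ i, j < i → ((j :: A).formPerm * r) i = i) →
      (jm j ^ k * Y) ((j :: A).formPerm * r) =
        cycleWeight g r * coeff A.length ((X * PowerSeries.mk g) ^ k) := by
  induction k with
  | zero =>
    simp only [pow_zero, one_mul]
    refine ⟨fun x hx => ?_, fun A r hd hr hs => ?_⟩
    · rw [hY, if_neg fun h => hx fun i hi => h i hi.le]
    · rw [hY, coeff_one, cycleWeight_formPerm_mul hg hd hr]
      -- For `k = 0` nothing is cut off, so only permutations fixing `j` contribute, those with `A`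
      -- empty.
      by_cases hA : A.length = 0
      · rw [if_pos hA, if_pos, hA, hg, one_mul, mul_one]
        intro i hi
        rcases hi.eq_or_lt with rfl | hi
        · rw [List.length_eq_zero_iff.1 hA, List.formPerm_singleton, one_mul]
          exact hr _ List.mem_cons_self
        · exact hs i hi
      · rw [if_neg hA, if_neg, mul_zero]
        intro h
        have h1 := h j le_rfl
        rw [Equiv.Perm.mul_apply, hr _ List.mem_cons_self,
          List.formPerm_apply_mem_eq_self_iff _ hd _ List.mem_cons_self] at h1
        simp only [List.length_cons] at h1
        omega
  | succ k ih =>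
    obtain ⟨ih1, ih2⟩ := ih
    have hfix : ∀ b, b < j → ∀ x : Perm (Fin n), (∀ i, j < i → (swap b j * x) i = i) ↔
        ∀ i, j < i → x i = i := by
      intro b hb x
      refine forall_congr' fun i => imp_congr_right fun hi => ?_
      have : swap b j i = i := swap_apply_of_ne_of_ne (by omega) (by omega)
      rw [Equiv.Perm.mul_apply]
      nth_rewrite 2 [← this]
      exact (swap b j).injective.eq_iff
    rw [pow_succ', mul_assoc]
    refine ⟨fun x hx => ?_, fun A r hd hr hs => ?_⟩
    · rw [jm_mul_apply]
      refine Finset.sum_eq_zero fun b hb => ?_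
      rw [ih1 _ (by rwa [hfix b (Finset.mem_Iio.1 hb)]), ite_self]
    -- The points of `A` are moved, while all points after `j` are fixed; so every `b ∈ A` gives a
    -- transposition occurring in `ξ_j`.
    · have hlt : ∀ b ∈ A, b < j := by
        intro b hb
        have hbj : b ≠ j := by
          rintro rfl
          exact (List.nodup_cons.1 hd).1 hb
        have hpos := List.length_pos_of_mem hb
        by_contra hlt
        have h1 := hs b (by omega)
        rw [Equiv.Perm.mul_apply, hr _ (List.mem_cons_of_mem _ hb),
          List.formPerm_apply_mem_eq_self_iff _ hd _ (List.mem_cons_of_mem _ hb)] at h1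
        simp only [List.length_cons] at h1
        omega
      -- Only `b ∈ A` lowers the degree. Summing over the position of `b` in `A` becomes the
      -- convolution of `F^k` with `F = X * mk g`; the last term of the convolution drops out since
      -- `F` has no constant term.
      rw [jm_mul_apply, ← Finset.sum_subset (s₁ := A.toFinset), List.sum_toFinset _ hd.of_cons,
        ← Fin.sum_univ_fun_getElem, pow_succ, coeff_mul, Finset.Nat.sum_antidiagonal_eq_sum_range_succ_mk,
        Finset.sum_range_succ, Nat.sub_self, coeff_zero_X_mul, mul_zero, add_zero, Finset.mul_sum,
        ← Fin.sum_univ_eq_sum_range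
          (fun i => cycleWeight g r * (coeff i ((X * PowerSeries.mk g) ^ k) *
            coeff (A.length - i) (X * PowerSeries.mk g))) A.length]
      · refine Finset.sum_congr rfl fun i _ => ?_
        -- The cut at `b = A[i]` keeps `j` and the `i` points before `b` in one cycle and splits off
        -- the arc starting at `b`.
        have hA : A.take i ++ A[i] :: A.drop (i + 1) = A := by simp
        generalize hb : A[(i : ℕ)] = b at *
        have hi : (A.take i).length = i := by simp
        generalize A.take i = A₁ at *
        generalize A.drop (i + 1) = A₂ at *
        obtain ⟨i, hi'⟩ := i
        simp only at *
        subst hA hi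
        rw [← List.cons_append] at hd hr hs ⊢
        have hr₂ : ∀ c ∈ b :: A₂, r c = c := fun c hc => hr c (List.mem_append_right _ hc)
        obtain ⟨hd₁, hd₂, hd₃⟩ := List.nodup_append'.1 hd
        have hr₁ : ∀ c ∈ j :: A₁, ((b :: A₂).formPerm * r) c = c := by
          intro c hc
          rw [Equiv.Perm.mul_apply, hr c (List.mem_append_left _ hc),
            List.formPerm_apply_of_notMem fun h => hd₃ hc h]
        have hx : swap b j * (((j :: A₁) ++ b :: A₂).formPerm * r) =
            (j :: A₁).formPerm * ((b :: A₂).formPerm * r) := by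
          rw [List.formPerm_cons_append_cons _ _ _ _ hd, swap_comm b j, ← mul_assoc, ← mul_assoc,
            swap_mul_self, one_mul, mul_assoc]
        have hbj : b < j := hlt b (by simp)
        rw [hx, if_pos, ih2 _ _ hd₁ hr₁, cycleWeight_formPerm_mul hg hd₂ hr₂]
        -- The arc `b :: A₂` has `A₂.length + 1` points and weight `g A₂.length`, which is the
        -- coefficient of `F` in degree `A₂.length + 1`.
        · have hl : (A₁ ++ b :: A₂).length - A₁.length = A₂.length + 1 := by simp
          rw [hl, coeff_succ_X_mul, coeff_mk]
          ring
        · rw [← hx, hfix b hbj]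
          exact hs
        · rw [permDeg_formPerm_mul hd₁ hr₁, permDeg_formPerm_mul hd₂ hr₂, List.cons_append,
            permDeg_formPerm_mul (A := A₁ ++ b :: A₂) hd hr, List.length_append, List.length_cons]
          ring
      · intro b hb
        exact Finset.mem_Iio.2 (hlt b (List.mem_toFinset.1 hb))
      · intro b hb hb'
        refine if_neg fun h => hb' (List.mem_toFinset.2 ?_)
        exact mem_of_permDeg_swap_mul hr (Finset.mem_Iio.1 hb).ne h

open PowerSeries in
/-- The multiplicative function whose weight `g` satisfies `F = z ∑ a_k F^k`, where
`F = ∑ g_k z^(k+1)`, is the product of the elements `∑ a_k ξ_j^k`. -/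
theorem sum_jm_pow_mul_apply (g : ℕ → ℤ) (hg : g 0 = 1) (a : ℕ → ℤ) (N : ℕ)
    (ha : ∀ m, m < n → g m = ∑ k ∈ Finset.range N, a k * coeff m ((X * PowerSeries.mk g) ^ k))
    (j : Fin n) (Y : GrGroupRing n)
    (hY : ∀ x, Y x = if ∀ i, j ≤ i → x i = i then cycleWeight g x else 0) (x : Perm (Fin n)) :
    ((∑ k ∈ Finset.range N, (a k : GrGroupRing n) * jm j ^ k) * Y) x =
      if ∀ i, j < i → x i = i then cycleWeight g x else 0 := by
  have hz : ∀ (c : ℤ) (f : GrGroupRing n), ((c : GrGroupRing n) * f) x = c * f x := by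
    intro c f
    rw [← zsmul_eq_mul]
    exact smul_eq_mul c (f x)
  rw [Finset.sum_mul, sum_apply]
  simp only [mul_assoc, hz]
  have h := fun k => jm_pow_mul_apply g hg j Y hY k
  split_ifs with hx
  · obtain ⟨A, r, hd, hr, rfl⟩ := exists_formPerm_mul x j
    rw [cycleWeight_formPerm_mul hg hd hr, ha, Finset.sum_mul]
    · refine Finset.sum_congr rfl fun k _ => ?_
      rw [(h k).2 A r hd hr hx]
      ring
    -- The cycle `j :: A` has at most `n` points, so `A.length < n`, as `ha` requires.
    · have := hd.length_le_card
      simpa using this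
  · refine Finset.sum_eq_zero fun k _ => ?_
    rw [(h k).1 x hx, mul_zero]

end GrGroupRing

namespace GrGroupRing

variable {n : ℕ}

/-- The factors are multiplied in the order of `j`, each enlarging the support from the permutations
that fix `j` and all later points to those that fix the later points only. The signs in `hb` come
from evaluating at `-ξ_j`. -/
theorem evalCommuting_prod_apply (g : ℕ → ℤ) (hg : g 0 = 1) (b : ℕ → ℤ) (N : ℕ)
    (hb : ∀ m, m < n → g m = ∑ k ∈ Finset.range N,
      (-1) ^ k * b k * PowerSeries.coeff m ((PowerSeries.X * PowerSeries.mk g) ^ k))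
    (hc : ∀ i j : Fin n, Commute (-jm i) (-jm j)) (x : Equiv.Perm (Fin n)) :
    evalCommuting (fun j => -jm j) hc (∏ j : Fin n, ∑ k ∈ Finset.range N,
      MvPolynomial.C (b k) * MvPolynomial.X j ^ k) x = cycleWeight g x := by
  -- The first `m` factors give the weight function cut down to the copy of `S_m` inside `S_n`; the
  -- empty product is the indicator of the identity.
  have key : ∀ m, m ≤ n → ∀ x : Equiv.Perm (Fin n), evalCommuting (fun j => -jm j) hc
      (∏ j : Fin n with j.1 < m, ∑ k ∈ Finset.range N,
        MvPolynomial.C (b k) * MvPolynomial.X j ^ k) x =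
      if ∀ i : Fin n, m ≤ i.1 → x i = i then cycleWeight g x else 0 := by
    intro m
    induction m with
    | zero =>
      intro _ x
      have : (∀ i : Fin n, 0 ≤ i.1 → x i = i) ↔ x = 1 := by
        simp [Equiv.ext_iff]
      simp only [Nat.not_lt_zero, Finset.filter_false, Finset.prod_empty, map_one, one_apply, this]
      split_ifs with h
      · rw [h, cycleWeight_one]
      · rfl
    | succ m ih =>
      intro hm x
      have hs : (Finset.univ.filter fun j : Fin n => j.1 < m + 1) =
          insert ⟨m, hm⟩ (Finset.univ.filter fun j : Fin n => j.1 < m) := by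
        ext j
        simp only [Finset.mem_filter, Finset.mem_univ, true_and, Finset.mem_insert, Fin.ext_iff]
        omega
      rw [hs, Finset.prod_insert (by simp), map_mul, map_sum]
      have hk : ∀ k, evalCommuting (fun j => -jm j) hc
          (MvPolynomial.C (b k) * MvPolynomial.X (⟨m, hm⟩ : Fin n) ^ k) =
          (((-1) ^ k * b k : ℤ) : GrGroupRing n) * jm ⟨m, hm⟩ ^ k := by
        intro k
        rw [map_mul, map_pow, evalCommuting_X, ← MvPolynomial.algebraMap_eq, eq_intCast, map_intCast,
          neg_pow, ← mul_assoc]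
        push_cast
        congr 1
        exact (Int.cast_commute _ _).eq
      simp only [hk]
      exact sum_jm_pow_mul_apply g hg (fun k => (-1) ^ k * b k) N hb ⟨m, hm⟩ _
        (fun x => ih (by omega) x) x
  have := key n le_rfl x
  simpa using this

end GrGroupRing

/-! ### Partitions as types of exponents -/

theorem Ptn.ext_parts {lam mu : Ptn} (h : lam.2.parts = mu.2.parts) : lam = mu := by
  obtain ⟨a, p⟩ := lam
  obtain ⟨b, q⟩ := mu
  have hab : a = b := by
    rw [← p.parts_sum, ← q.parts_sum]
    exact congrArg Multiset.sum h
  subst hab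
  congr 1
  exact Nat.Partition.ext h

/-- The partition whose parts are the elements of a multiset of positive numbers. -/
def Ptn.ofParts (s : Multiset ℕ) (hs : ∀ a ∈ s, 0 < a) : Ptn :=
  ⟨s.sum, ⟨s, fun {a} h => hs a h, rfl⟩⟩

theorem Ptn.ofParts_eq_iff {s : Multiset ℕ} {hs : ∀ a ∈ s, 0 < a} {lam : Ptn} :
    Ptn.ofParts s hs = lam ↔ s = lam.2.parts :=
  ⟨fun h => by rw [← h]; rfl, fun h => Ptn.ext_parts h⟩

/-- The partition formed by the exponents of a monomial. -/
def expType {n : ℕ} (d : Fin n →₀ ℕ) : Ptn :=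
  Ptn.ofParts (d.support.val.map d) fun a ha => by
    obtain ⟨i, hi, rfl⟩ := Multiset.mem_map.1 ha
    exact Nat.pos_of_ne_zero (Finsupp.mem_support_iff.1 hi)

theorem expType_eq_iff {n : ℕ} {d : Fin n →₀ ℕ} {lam : Ptn} :
    expType d = lam ↔ d.support.val.map d = lam.2.parts := Ptn.ofParts_eq_iff

theorem expType_parts {n : ℕ} (d : Fin n →₀ ℕ) :
    (expType d).2.parts = d.support.val.map d := rfl

theorem expType_fst {n : ℕ} (d : Fin n →₀ ℕ) : (expType d).1 = d.degree := rfl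

theorem expType_mapDomain {n m : ℕ} {f : Fin n → Fin m} (hf : Function.Injective f)
    (d : Fin n →₀ ℕ) : expType (d.mapDomain f) = expType d := by
  rw [expType_eq_iff, expType_parts, Finsupp.mapDomain_support_of_injective hf,
    Finset.image_val_of_injOn hf.injOn, Multiset.map_map]
  refine Multiset.map_congr rfl fun i _ => ?_
  simp [Finsupp.mapDomain_apply hf]

/-- Two exponent vectors with the same nonzero entries take each value equally often, so a
permutation can match their fibres. -/
theorem exists_perm_of_expType_eq {n : ℕ} {d d' : Fin n →₀ ℕ} (h : expType d = expType d') :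
    ∃ σ : Equiv.Perm (Fin n), d.mapDomain σ = d' := by
  have h1 : d.support.val.map d = d'.support.val.map d' := expType_eq_iff.1 h
  have h2 : ∀ (d : Fin n →₀ ℕ) (c : ℕ), c ≠ 0 →
      Fintype.card {a // d a = c} = (d.support.val.map d).count c := by
    intro d c hc
    rw [Multiset.count_map, Fintype.card_subtype, Finset.card_def, Finset.filter_val,
      ← Finset.filter_val, ← Finset.filter_val]
    congr 2
    ext i
    simp only [Finset.mem_filter, Finset.mem_univ, true_and, Finsupp.mem_support_iff]
    grind
  have h3 : ∀ c : ℕ, Fintype.card {a // d a = c} = Fintype.card {a // d' a = c} := by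
    intro c
    by_cases hc : c = 0
    · subst hc
      -- The type does not record zeros; their number is what remains of the `n` positions.
      have h4 : ∀ d : Fin n →₀ ℕ, Fintype.card {a // d a = 0} +
          Multiset.card (d.support.val.map d) = n := by
        intro d
        rw [Multiset.card_map, Finset.card_val, Fintype.card_subtype]
        have := Finset.card_filter_add_card_filter_not (s := (Finset.univ : Finset (Fin n)))
          (fun a => d a = 0)
        rw [Finset.card_univ, Fintype.card_fin] at this
        refine Eq.trans ?_ this
        congr 2
        ext i
        simp
      have h5 := h4 d
      have h6 := h4 d'
      rw [h1] at h5
      omega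
    · rw [h2 d c hc, h2 d' c hc, h1]
  let e : ∀ c : ℕ, {a // d a = c} ≃ {a // d' a = c} := fun c => Fintype.equivOfCardEq (h3 c)
  refine ⟨Equiv.ofFiberEquiv e, ?_⟩
  ext i
  obtain ⟨j, rfl⟩ := (Equiv.ofFiberEquiv e).surjective i
  rw [Finsupp.mapDomain_apply (Equiv.injective _), Equiv.ofFiberEquiv_map (f := d) (g := d') e]

/-- A partition of `N` has at most `N` parts, so `N` variables suffice to realise it. This fixes
where coefficients are read off and why degree `N` is determined in `N` variables. -/
theorem exists_expType_eq (lam : Ptn) : ∃ d : Fin lam.1 →₀ ℕ, expType d = lam := by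
  have hc : lam.2.parts.toList.length ≤ lam.1 := by
    rw [Multiset.length_toList]
    conv_rhs => rw [← lam.2.parts_sum]
    have := Multiset.card_nsmul_le_sum (s := lam.2.parts) (a := 1) fun a ha => lam.2.parts_pos ha
    simpa using this
  let d₀ : Fin lam.2.parts.toList.length →₀ ℕ := Finsupp.equivFunOnFinite.symm lam.2.parts.toList.get
  refine ⟨d₀.mapDomain (Fin.castLE hc), ?_⟩
  rw [expType_mapDomain (Fin.castLE_injective hc), expType_eq_iff]
  have hs : d₀.support = Finset.univ := by
    ext i
    have : 0 < lam.2.parts.toList.get i :=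
      lam.2.parts_pos (Multiset.mem_toList.1 (List.get_mem _ i))
    simpa [d₀] using this.ne'
  rw [hs]
  have h2 : (Finset.univ : Finset (Fin lam.2.parts.toList.length)).val.map
      lam.2.parts.toList.get = (lam.2.parts.toList : Multiset ℕ) := by
    rw [Fin.univ_val_map, List.ofFn_get]
  rw [Multiset.coe_toList] at h2
  exact h2

/-! ### Coefficients of symmetric functions and the basis of monomial functions -/

namespace SymFun

open MvPolynomial

theorem coeff_killLast {n : ℕ} (p : MvPolynomial (Fin (n + 1)) ℤ) (d : Fin n →₀ ℕ) :
    coeff d (killLast n p) = coeff (d.mapDomain Fin.castSucc) p := by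
  have : killLast n = killCompl (R := ℤ) (Fin.castSucc_injective n) := by
    ext1 i
    induction i using Fin.lastCases with
    | last => simp [killLast_last, killCompl]
    | cast i =>
      rw [killLast_castSucc, ← rename_X (R := ℤ) Fin.castSucc, killCompl_rename_app]
  rw [this, coeff_killCompl]

theorem coeff_castLE (f : SymFun) {n m : ℕ} (h : n ≤ m) (d : Fin n →₀ ℕ) :
    coeff d (f.1 n) = coeff (d.mapDomain (Fin.castLE h)) (f.1 m) := by
  induction m, h using Nat.le_induction with
  | base => simp
  | succ m h ih =>
    rw [ih, ← f.2.2.1 m, coeff_killLast, ← Finsupp.mapDomain_comp]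
    rfl

/-- Compatibility moves both coefficients into a common number of variables; symmetry then matches
the monomials. Hence a symmetric function has a well-defined coefficient for each partition. -/
theorem coeff_eq_of_expType (f : SymFun) {n m : ℕ} {d : Fin n →₀ ℕ} {d' : Fin m →₀ ℕ}
    (h : expType d = expType d') : coeff d (f.1 n) = coeff d' (f.1 m) := by
  have h1 := expType_mapDomain (Fin.castLE_injective (le_max_left n m)) d
  have h2 := expType_mapDomain (Fin.castLE_injective (le_max_right n m)) d'
  rw [coeff_castLE f (le_max_left n m), coeff_castLE f (le_max_right n m)]
  obtain ⟨σ, hσ⟩ := exists_perm_of_expType_eq (h1.trans (h.trans h2.symm))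
  rw [← hσ]
  conv_rhs => rw [← f.2.1 (max n m) σ]
  rw [coeff_rename_mapDomain _ σ.injective]

/-- The coefficient of a symmetric function at the monomials with exponents `lam`. -/
noncomputable def mCoeff (lam : Ptn) : SymFun →ₗ[ℤ] ℤ :=
  AddMonoidHom.toIntLinearMap
    { toFun := fun f => coeff (exists_expType_eq lam).choose (f.1 lam.1)
      map_zero' := coeff_zero _
      map_add' := fun _ _ => coeff_add _ _ _ }

theorem mCoeff_expType (f : SymFun) {n : ℕ} (d : Fin n →₀ ℕ) :
    mCoeff (expType d) f = coeff d (f.1 n) :=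
  coeff_eq_of_expType f (exists_expType_eq (expType d)).choose_spec

theorem prod_map_X {n : ℕ} (s : Multiset (Fin n)) :
    (s.map (X : Fin n → MvPolynomial (Fin n) ℤ)).prod = monomial (Multiset.toFinsupp s) 1 := by
  induction s using Multiset.induction_on with
  | empty => simp
  | cons a s ih =>
    rw [Multiset.map_cons, Multiset.prod_cons, ih, X, monomial_mul, ← Multiset.singleton_add,
      map_add, Multiset.toFinsupp_singleton, one_mul]

theorem coeff_m (lam : Ptn) {n : ℕ} (d : Fin n →₀ ℕ) :
    coeff d ((m lam).1 n) = if expType d = lam then 1 else 0 := by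
  have h1 : ∀ s : Multiset (Fin n), Multiset.toFinsupp s = d ↔ s = Finsupp.toMultiset d := by
    intro s
    exact ⟨fun h => by rw [← h, Multiset.toFinsupp_toMultiset],
      fun h => by rw [h, Finsupp.toMultiset_toFinsupp]⟩
  have h2 : (Finsupp.toMultiset d).dedup.map (Finsupp.toMultiset d).count =
      d.support.val.map d := by
    rw [← Multiset.toFinset_val, Finsupp.toFinset_toMultiset]
    exact Multiset.map_congr rfl fun i _ => Finsupp.count_toMultiset d i
  change coeff d (msymm (Fin n) ℤ lam.2) = _
  rw [msymm_eq, coeff_sum]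
  simp only [prod_map_X, coeff_monomial]
  by_cases h : expType d = lam
  · have hcard : (Finsupp.toMultiset d).card = lam.1 := by
      rw [Finsupp.card_toMultiset, ← h, expType_fst]
      rfl
    rw [if_pos h, Finset.sum_eq_single ⟨Finsupp.toMultiset d, hcard⟩]
    · rw [if_pos ((h1 _).2 rfl)]
    · intro s _ hs
      rw [if_neg]
      intro h'
      exact hs (Subtype.ext ((h1 s.1).1 h'))
    · intro hs
      refine absurd (Finset.mem_filter.2 ⟨Finset.mem_univ _, ?_⟩) hs
      ext1
      exact h2.trans (expType_eq_iff.1 h)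
  · rw [if_neg h]
    refine Finset.sum_eq_zero fun s hs => if_neg fun h' => h ?_
    rw [expType_eq_iff, ← (Finset.mem_filter.1 hs).2, ← h2, ← (h1 _).1 h']
    rfl

theorem mCoeff_m (lam mu : Ptn) : mCoeff lam (m mu) = if lam = mu then 1 else 0 := by
  obtain ⟨d, hd⟩ := exists_expType_eq lam
  rw [← hd, mCoeff_expType, coeff_m]

theorem ext_mCoeff {f g : SymFun} (h : ∀ lam, mCoeff lam f = mCoeff lam g) : f = g := by
  ext1
  funext n
  ext d
  rw [← mCoeff_expType, ← mCoeff_expType, h]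

/-- The partitions of the numbers up to `N`. -/
def ptnsLE (N : ℕ) : Finset Ptn := (Finset.range (N + 1)).sigma fun _ => Finset.univ

theorem mem_ptnsLE {N : ℕ} {lam : Ptn} : lam ∈ ptnsLE N ↔ lam.1 ≤ N := by
  simp [ptnsLE]

theorem mCoeff_eq_zero {f : SymFun} {N : ℕ} (hN : ∀ n, (f.1 n).totalDegree ≤ N) {lam : Ptn}
    (h : N < lam.1) : mCoeff lam f = 0 := by
  obtain ⟨d, hd⟩ := exists_expType_eq lam
  rw [← hd, mCoeff_expType]
  refine coeff_eq_zero_of_totalDegree_lt ((hN _).trans_lt ?_)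
  rw [← hd, expType_fst] at h
  exact h

theorem eq_sum_mCoeff {f : SymFun} {N : ℕ} (hN : ∀ n, (f.1 n).totalDegree ≤ N) :
    f = ∑ lam ∈ ptnsLE N, mCoeff lam f • m lam := by
  refine ext_mCoeff fun mu => ?_
  simp only [map_sum, map_smul, mCoeff_m, smul_eq_mul, mul_ite, mul_one, mul_zero,
    Finset.sum_ite_eq, mem_ptnsLE]
  split_ifs with h
  · rfl
  · exact mCoeff_eq_zero hN (by omega)

/-- The monomial symmetric functions form a basis. -/
noncomputable def mBasis : Module.Basis Ptn ℤ SymFun :=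
  Module.Basis.mk (v := m)
    (by
      rw [linearIndependent_iff']
      intro s g hg lam hlam
      have := congrArg (mCoeff lam) hg
      simpa only [map_sum, map_smul, mCoeff_m, smul_eq_mul, mul_ite, mul_one, mul_zero,
        Finset.sum_ite_eq, hlam, if_true, map_zero] using this)
    (by
      intro f _
      obtain ⟨N, hN⟩ := f.2.2.2
      rw [eq_sum_mCoeff hN]
      exact Submodule.sum_mem _ fun lam _ =>
        Submodule.smul_mem _ _ (Submodule.subset_span ⟨lam, rfl⟩))

theorem mBasis_apply (lam : Ptn) : mBasis lam = m lam := Module.Basis.mk_apply _ _ _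

end SymFun

/-! ### Homogeneity, free generation by the elementary functions, generating functions -/

namespace SymFun

open MvPolynomial

/-- The polynomial in `n` variables underlying a symmetric function. -/
noncomputable def level (n : ℕ) : SymFun →ₐ[ℤ] MvPolynomial (Fin n) ℤ :=
  ((Pi.evalRingHom (fun n => MvPolynomial (Fin n) ℤ) n).comp SymFun.subtype).toIntAlgHom

theorem level_apply (n : ℕ) (f : SymFun) : level n f = f.1 n := rfl

theorem ext_level {f g : SymFun} (h : ∀ n, level n f = level n g) : f = g :=
  Subtype.ext (funext h)

/-- A symmetric function is homogeneous of degree `d`. -/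
def IsHomog (f : SymFun) (d : ℕ) : Prop := ∀ n : ℕ, (f.1 n).IsHomogeneous d

theorem isHomog_e (k : ℕ) : IsHomog (e k) k := fun n => by
  change (esymm (Fin n) ℤ k).IsHomogeneous k
  rw [esymm]
  refine IsHomogeneous.sum _ _ _ fun s hs => ?_
  have := IsHomogeneous.prod s (X : Fin n → MvPolynomial (Fin n) ℤ) (fun _ => 1)
    fun i _ => isHomogeneous_X _ _
  simpa [(Finset.mem_powersetCard.1 hs).2] using this

theorem isHomogeneous_prod_map_X {n k : ℕ} (s : Sym (Fin n) k) :
    ((s.1.map (X : Fin n → MvPolynomial (Fin n) ℤ)).prod).IsHomogeneous k := by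
  rw [prod_map_X]
  refine isHomogeneous_monomial _ ?_
  have h2 := Finsupp.card_toMultiset (Multiset.toFinsupp s.1)
  rw [Multiset.toFinsupp_toMultiset] at h2
  exact h2.symm.trans s.2

theorem isHomog_h (k : ℕ) : IsHomog (h k) k := fun _ =>
  IsHomogeneous.sum _ _ _ fun s _ => isHomogeneous_prod_map_X s

theorem isHomog_m (lam : Ptn) : IsHomog (m lam) lam.1 := fun n => by
  change (msymm (Fin n) ℤ lam.2).IsHomogeneous _
  rw [msymm_eq]
  exact IsHomogeneous.sum _ _ _ fun s _ => isHomogeneous_prod_map_X s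

theorem isHomog_one : IsHomog 1 0 := fun _ => isHomogeneous_one _ _

theorem IsHomog.mul {f g : SymFun} {a b : ℕ} (hf : IsHomog f a) (hg : IsHomog g b) :
    IsHomog (f * g) (a + b) := fun n => (hf n).mul (hg n)

theorem IsHomog.sub {f g : SymFun} {a : ℕ} (hf : IsHomog f a) (hg : IsHomog g a) :
    IsHomog (f - g) a := fun n => (hf n).sub (hg n)

theorem isHomog_zero (d : ℕ) : IsHomog 0 d := fun _ => isHomogeneous_zero _ _ _

theorem isHomog_sum {ι : Type*} (s : Finset ι) (f : ι → SymFun) (d : ℕ)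
    (hf : ∀ i ∈ s, IsHomog (f i) d) : IsHomog (∑ i ∈ s, f i) d := fun n => by
  rw [← level_apply, map_sum]
  exact IsHomogeneous.sum _ _ _ fun i hi => hf i hi n

theorem IsHomog.mCoeff_eq_zero {f : SymFun} {d : ℕ} (hf : IsHomog f d) {lam : Ptn}
    (h : lam.1 ≠ d) : mCoeff lam f = 0 := by
  obtain ⟨c, hc⟩ := exists_expType_eq lam
  rw [← hc, mCoeff_expType]
  refine (hf _).coeff_eq_zero ?_
  rw [← hc, expType_fst] at h
  exact h

theorem isHomog_multiset_prod {F : ℕ → SymFun} (hF : ∀ k, IsHomog (F k) k) (s : Multiset ℕ) :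
    IsHomog (s.map F).prod s.sum := by
  induction s using Multiset.induction_on with
  | empty => simpa using isHomog_one
  | cons a s ih =>
    rw [Multiset.map_cons, Multiset.prod_cons, Multiset.sum_cons]
    exact (hF a).mul ih

theorem isHomog_part {F : ℕ → SymFun} (hF : ∀ k, IsHomog (F k) k) (lam : Ptn) :
    IsHomog (lam.2.parts.map F).prod lam.1 := by
  have := isHomog_multiset_prod hF lam.2.parts
  rwa [lam.2.parts_sum] at this

/-- The homomorphism from the polynomial ring that sends the `i`-th variable to `e_{i+1}`. -/
noncomputable def eHom : MvPolynomial ℕ ℤ →ₐ[ℤ] SymFun := aeval fun i => e (i + 1)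

theorem level_eHom_rename {n N : ℕ} (Q : MvPolynomial (Fin n) ℤ) :
    level N (eHom (rename Fin.val Q)) = (esymmAlgHom (Fin N) ℤ n Q).1 := by
  rw [esymmAlgHom_apply, eHom, aeval_rename]
  change (level N).comp (aeval _) Q = _
  congr 1
  ext1 i
  simp only [AlgHom.comp_apply, aeval_X, Function.comp_apply]
  rfl

/-- A polynomial involves finitely many of the `e_k`, and these are already independent in
sufficiently many variables. -/
theorem eHom_injective : Function.Injective eHom := by
  rw [injective_iff_map_eq_zero]
  intro P hP
  obtain ⟨s, q, rfl⟩ := exists_finset_rename P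
  have hs : ∀ x : {x // x ∈ s}, x.1 < s.sup id + 1 := fun x =>
    Nat.lt_succ_of_le (Finset.le_sup (f := id) x.2)
  let ι : {x // x ∈ s} → Fin (s.sup id + 1) := fun x => ⟨x.1, hs x⟩
  have h1 : rename Subtype.val q = rename Fin.val (rename ι q) := by
    rw [rename_rename]
    rfl
  rw [h1] at hP ⊢
  have h2 := level_eHom_rename (N := s.sup id + 1) (rename ι q)
  rw [hP, map_zero] at h2
  have h3 := esymmAlgHom_fin_injective (m := s.sup id + 1) ℤ le_rfl
    (a₁ := rename ι q) (a₂ := 0) (by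
      rw [map_zero]
      exact Subtype.ext h2.symm)
  rw [h3, map_zero]

theorem isHomog_eHom_monomial (s : ℕ →₀ ℕ) (c : ℤ) :
    IsHomog (eHom (monomial s c)) (Finsupp.weight (fun i => i + 1) s) := by
  intro n
  rw [← level_apply, eHom, aeval_monomial, map_mul, Finsupp.prod, map_prod, Finsupp.weight_apply,
    Finsupp.sum, ← zero_add (∑ _ ∈ _, _)]
  refine IsHomogeneous.mul ?_ (IsHomogeneous.prod _ _ _ fun i _ => ?_)
  · rw [AlgHom.commutes]
    exact isHomogeneous_C _ _
  · rw [map_pow, smul_eq_mul, mul_comm]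
    exact (isHomog_e (i + 1) n).pow _

/-- Giving the `i`-th variable the weight `i + 1`, the degree of its image, makes `eHom` a graded
map. -/
theorem level_eHom_component (n d : ℕ) (P : MvPolynomial ℕ ℤ) :
    level n (eHom (weightedHomogeneousComponent (fun i => i + 1) d P)) =
      homogeneousComponent d (level n (eHom P)) := by
  induction P using MvPolynomial.induction_on' with
  | monomial s c =>
    rw [weightedHomogeneousComponent_of_mem
      ((mem_weightedHomogeneousSubmodule _ _ _ _).2 (isWeightedHomogeneous_monomial _ s c rfl)),
      homogeneousComponent_of_mem (p := level n (eHom (monomial s c))) (isHomog_eHom_monomial s c n)]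
    split_ifs <;> simp
  | add p q hp hq => simp only [map_add, hp, hq]

theorem IsHomog.mem_range_eHom {f : SymFun} {N : ℕ} (hf : IsHomog f N) : ∃ P, eHom P = f := by
  obtain ⟨Q, hQ⟩ := esymmAlgHom_fin_surjective (m := N) ℤ le_rfl ⟨f.1 N, f.2.1 N⟩
  -- `Q` represents `f` in `N` variables only. Its component of weight `N` is homogeneous in every
  -- number of variables, and an element homogeneous of degree `N` is determined by its `N`-variable
  -- polynomial.
  refine ⟨weightedHomogeneousComponent (fun i => i + 1) N (rename Fin.val Q), ?_⟩
  have h1 : IsHomog (eHom (weightedHomogeneousComponent (fun i => i + 1) N (rename Fin.val Q))) N :=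
    fun n => by
      rw [← level_apply, level_eHom_component]
      exact homogeneousComponent_isHomogeneous _ _
  have h2 : level N (eHom (weightedHomogeneousComponent (fun i => i + 1) N (rename Fin.val Q))) =
      f.1 N := by
    rw [level_eHom_component, level_eHom_rename, hQ]
    exact homogeneousComponent_eq_self (hf N)
  refine ext_mCoeff fun mu => ?_
  by_cases hmu : mu.1 = N
  · subst hmu
    obtain ⟨d, hd⟩ := exists_expType_eq mu
    have h3 := fun g => mCoeff_expType g d
    rw [hd] at h3
    rw [h3, h3, ← level_apply, h2]
  · rw [h1.mCoeff_eq_zero hmu, hf.mCoeff_eq_zero hmu]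

theorem eHom_surjective : Function.Surjective eHom := by
  have h : ∀ f : SymFun, f ∈ LinearMap.range eHom.toLinearMap := by
    intro f
    have hf : f ∈ Submodule.span ℤ (Set.range mBasis) := by
      rw [mBasis.span_eq]
      trivial
    refine Submodule.span_le.2 ?_ hf
    rintro _ ⟨lam, rfl⟩
    rw [mBasis_apply]
    exact (isHomog_m lam).mem_range_eHom
  exact h

/-- The ring of symmetric functions is the polynomial ring in `e₁, e₂, …`. -/
noncomputable def eEquiv : MvPolynomial ℕ ℤ ≃ₐ[ℤ] SymFun :=
  AlgEquiv.ofBijective eHom ⟨eHom_injective, eHom_surjective⟩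

theorem eEquiv_X (i : ℕ) : eEquiv (X i) = e (i + 1) := aeval_X _ _

theorem e_zero : e 0 = 1 := by
  ext1
  funext n
  exact esymm_zero (Fin n) ℤ

theorem ringHom_ext_e {A : Type*} [Ring A] {f g : SymFun →+* A} (hfg : ∀ k, f (e k) = g (e k)) :
    f = g := by
  have h1 : f.comp (eEquiv : MvPolynomial ℕ ℤ →+* SymFun) =
      g.comp (eEquiv : MvPolynomial ℕ ℤ →+* SymFun) := by
    refine MvPolynomial.ringHom_ext (fun r => ?_) fun i => ?_
    · simp
    · have := hfg (i + 1)
      rw [← eEquiv_X] at this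
      exact this
  ext x
  have := congrArg (fun F : MvPolynomial ℕ ℤ →+* A => F (eEquiv.symm x)) h1
  simpa using this

theorem prod_one_add_mul {A : Type*} [CommRing A] {n : ℕ} (t : Fin n → A) (y : A) :
    ∏ i, (1 + y * t i) = ∑ k ∈ Finset.range (n + 1), y ^ k *
      ∑ s ∈ Finset.powersetCard k (Finset.univ : Finset (Fin n)), ∏ i ∈ s, t i := by
  rw [Finset.prod_one_add, Finset.sum_powerset, Finset.card_univ, Fintype.card_fin]
  refine Finset.sum_congr rfl fun k _ => ?_
  rw [Finset.mul_sum]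
  refine Finset.sum_congr rfl fun s hs => ?_
  rw [Finset.prod_mul_distrib, Finset.prod_const, (Finset.mem_powersetCard.1 hs).2]

/-- Expanding the product of geometric series, each monomial of degree `k` appears once. -/
theorem mk_hsymm (n : ℕ) : PowerSeries.mk (hsymm (Fin n) ℤ) =
    ∏ i : Fin n, PowerSeries.mk fun k => (X i : MvPolynomial (Fin n) ℤ) ^ k := by
  ext1 k
  rw [PowerSeries.coeff_prod, PowerSeries.coeff_mk, hsymm]
  simp only [prod_map_X, PowerSeries.coeff_mk]
  refine Finset.sum_bij (fun s _ => Multiset.toFinsupp s.1) (fun s _ => ?_) (fun s _ t _ hst => ?_)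
    (fun l hl => ?_) fun s _ => ?_
  · have h2 := Finsupp.card_toMultiset (Multiset.toFinsupp s.1)
    rw [Multiset.toFinsupp_toMultiset, Finsupp.sum_fintype _ _ (fun _ => rfl)] at h2
    rw [Finset.mem_finsuppAntidiag]
    exact ⟨h2.symm.trans s.2, Finset.subset_univ _⟩
  · exact Subtype.ext (Multiset.toFinsupp.injective hst)
  · refine ⟨⟨Finsupp.toMultiset l, ?_⟩, Finset.mem_univ _, Finsupp.toMultiset_toFinsupp l⟩
    rw [Finsupp.card_toMultiset, Finsupp.sum_fintype _ _ (fun _ => rfl)]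
    simpa [Finset.mem_finsuppAntidiag] using hl
  · rw [monomial_eq, C_1, one_mul, Finsupp.prod_fintype _ _ (fun _ => pow_zero _)]

/-- The generating function of the complete symmetric functions. -/
noncomputable def hSeries : PowerSeries SymFun := PowerSeries.mk h

/-- The generating function of the elementary symmetric functions. -/
noncomputable def eSeries : PowerSeries SymFun := PowerSeries.mk e

/-- In `n` variables `H(t) = ∏ 1 / (1 - x_i t)` and `E(-t) = ∏ (1 - x_i t)` cancel factor by factor;
an identity in `Λ` is detected in finitely many variables. -/
theorem hSeries_mul : hSeries * PowerSeries.rescale (-1) eSeries = 1 := by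
  have key : ∀ n, PowerSeries.map (level n : SymFun →+* MvPolynomial (Fin n) ℤ)
      (hSeries * PowerSeries.rescale (-1) eSeries) = 1 := by
    intro n
    have h1 : PowerSeries.map (level n : SymFun →+* MvPolynomial (Fin n) ℤ) hSeries =
        PowerSeries.mk (hsymm (Fin n) ℤ) := by
      ext1 k
      simp only [PowerSeries.coeff_map, hSeries, PowerSeries.coeff_mk]
      rfl
    have h2 : PowerSeries.map (level n : SymFun →+* MvPolynomial (Fin n) ℤ)
        (PowerSeries.rescale (-1) eSeries) =
        ∏ i : Fin n, (1 + (-PowerSeries.X) * PowerSeries.C (X i : MvPolynomial (Fin n) ℤ)) := by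
      rw [prod_one_add_mul]
      have h3 : ∀ k, ∑ s ∈ Finset.powersetCard k (Finset.univ : Finset (Fin n)),
          ∏ i ∈ s, PowerSeries.C (X i : MvPolynomial (Fin n) ℤ) =
          PowerSeries.C (esymm (Fin n) ℤ k) := by
        intro k
        simp only [esymm, map_sum, map_prod]
      simp only [h3]
      ext1 k
      have h4 : ∀ j, PowerSeries.coeff k ((-PowerSeries.X) ^ j *
          PowerSeries.C (esymm (Fin n) ℤ j)) = if k = j then (-1) ^ j * esymm (Fin n) ℤ j else 0 := by
        intro j
        rw [PowerSeries.coeff_mul_C, neg_pow, ← map_one (PowerSeries.C (R := MvPolynomial (Fin n) ℤ)),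
          ← map_neg, ← map_pow, PowerSeries.coeff_C_mul, PowerSeries.coeff_X_pow]
        split_ifs <;> simp
      simp only [map_sum, h4, Finset.sum_ite_eq, PowerSeries.coeff_map, PowerSeries.coeff_rescale,
        eSeries, PowerSeries.coeff_mk]
      have h5 : (level n : SymFun →+* MvPolynomial (Fin n) ℤ) ((-1) ^ k * e k) =
          (-1) ^ k * esymm (Fin n) ℤ k := by
        rw [map_mul, map_pow, map_neg, map_one]
        rfl
      rw [h5]
      split_ifs with hk
      · rfl
      · rw [esymm, Finset.powersetCard_eq_empty.2, Finset.sum_empty, mul_zero]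
        simpa using hk
    rw [map_mul, h1, h2, mk_hsymm, ← Finset.prod_mul_distrib]
    refine Finset.prod_eq_one fun i _ => ?_
    ext1 k
    rw [mul_add, mul_one, map_add, neg_mul, mul_neg, ← mul_assoc, map_neg, PowerSeries.coeff_mul_C]
    cases k with
    | zero => simp
    | succ k =>
      rw [PowerSeries.coeff_succ_mul_X]
      simp [pow_succ, PowerSeries.coeff_one]
  ext1 k
  refine ext_level fun n => ?_
  have := congrArg (PowerSeries.coeff k) (key n)
  rw [PowerSeries.coeff_map, PowerSeries.coeff_one] at this
  refine this.trans ?_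
  rw [PowerSeries.coeff_one]
  split_ifs <;> simp

end SymFun

/-! ### Multiplicative bases, the standard involution and the standard form -/

/-- Partitions correspond to exponents of monomials in variables indexed by `ℕ`, a part `k + 1`
corresponding to the variable of index `k`. -/
noncomputable def Ptn.equivFinsupp : (ℕ →₀ ℕ) ≃ Ptn where
  toFun d := Ptn.ofParts ((Finsupp.toMultiset d).map (· + 1)) fun a ha => by
    obtain ⟨b, -, rfl⟩ := Multiset.mem_map.1 ha
    exact Nat.succ_pos b
  invFun lam := Multiset.toFinsupp (lam.2.parts.map (· - 1))
  left_inv d := by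
    change Multiset.toFinsupp (((Finsupp.toMultiset d).map (· + 1)).map (· - 1)) = d
    rw [Multiset.map_map]
    simp
  right_inv lam := by
    rw [Ptn.ofParts_eq_iff, Multiset.toFinsupp_toMultiset, Multiset.map_map]
    conv_rhs => rw [← Multiset.map_id lam.2.parts]
    refine Multiset.map_congr rfl fun a ha => ?_
    have := lam.2.parts_pos ha
    simp only [Function.comp_apply, id_eq]
    omega

namespace SymFun

open MvPolynomial

/-- Free polynomial generators `F₁, F₂, …` of `Λ` give a basis of products `F_λ`. -/
noncomputable def partBasis (E : MvPolynomial ℕ ℤ ≃ₐ[ℤ] SymFun) : Module.Basis Ptn ℤ SymFun :=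
  ((basisMonomials ℕ ℤ).map E.toLinearEquiv).reindex Ptn.equivFinsupp

theorem partBasis_apply {E : MvPolynomial ℕ ℤ ≃ₐ[ℤ] SymFun} {F : ℕ → SymFun}
    (hF : ∀ i, E (X i) = F (i + 1)) (lam : Ptn) :
    partBasis E lam = (lam.2.parts.map F).prod := by
  obtain ⟨d, rfl⟩ := Ptn.equivFinsupp.surjective lam
  rw [partBasis, Module.Basis.reindex_apply, Equiv.symm_apply_apply, Module.Basis.map_apply,
    coe_basisMonomials]
  change E (monomial d 1) = (((Finsupp.toMultiset d).map (· + 1)).map F).prod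
  rw [Multiset.map_map, monomial_eq, C_1, one_mul, Finsupp.prod, map_prod, Finsupp.toMultiset_map,
    Finsupp.prod_toMultiset, Finsupp.prod_mapDomain_index (fun _ => pow_zero _)
      (fun _ _ _ => pow_add _ _ _), Finsupp.prod]
  refine Finset.prod_congr rfl fun i _ => ?_
  rw [map_pow, hF, Function.comp_apply]

/-- The endomorphism of `Λ` that sends `e_k` to `h_k`. -/
noncomputable def omegaHom : SymFun →ₐ[ℤ] SymFun :=
  (aeval fun i => h (i + 1)).comp eEquiv.symm.toAlgHom

theorem omegaHom_e (k : ℕ) : omegaHom (e k) = h k := by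
  cases k with
  | zero => rw [e_zero, h_zero, map_one]
  | succ k =>
    rw [← eEquiv_X]
    simp [omegaHom]

/-- Applying `ω` to `H(t) E(-t) = 1` gives `ω(H)(t) H(-t) = 1`, whereas `E(t) H(-t) = 1`; inverses
are unique. -/
theorem omegaHom_h (k : ℕ) : omegaHom (h k) = e k := by
  set F : SymFun →+* SymFun := (omegaHom : SymFun →+* SymFun)
  have h1 : PowerSeries.map F eSeries = hSeries := by
    ext1 k
    simp only [PowerSeries.coeff_map, eSeries, hSeries, PowerSeries.coeff_mk]
    exact omegaHom_e k
  have h2 := congrArg (PowerSeries.map F) hSeries_mul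
  have h3 := congrArg (PowerSeries.rescale (-1)) hSeries_mul
  rw [map_mul, ← PowerSeries.rescale_map, h1, map_one, map_neg, map_one] at h2
  rw [map_mul, PowerSeries.rescale_rescale, map_one, neg_one_mul, neg_neg, PowerSeries.rescale_one,
    RingHom.id_apply] at h3
  have h4 : PowerSeries.map F hSeries = eSeries := by
    calc PowerSeries.map F hSeries
        = PowerSeries.map F hSeries * (PowerSeries.rescale (-1) hSeries * eSeries) := by
          rw [h3, mul_one]
      _ = eSeries := by rw [← mul_assoc, h2, one_mul]
  have h5 := congrArg (PowerSeries.coeff k) h4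
  simp only [PowerSeries.coeff_map, eSeries, hSeries, PowerSeries.coeff_mk] at h5
  exact h5

theorem omegaHom_omegaHom (f : SymFun) : omegaHom (omegaHom f) = f := by
  have h : (omegaHom : SymFun →+* SymFun).comp (omegaHom : SymFun →+* SymFun) = RingHom.id _ :=
    ringHom_ext_e fun k => by
      change omegaHom (omegaHom (e k)) = e k
      rw [omegaHom_e, omegaHom_h]
  exact congrArg (fun F : SymFun →+* SymFun => F f) h

/-- The standard involution of `Λ`. -/
noncomputable def omegaEquiv : SymFun ≃ₐ[ℤ] SymFun :=
  AlgEquiv.ofAlgHom omegaHom omegaHom (AlgHom.ext omegaHom_omegaHom) (AlgHom.ext omegaHom_omegaHom)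

theorem existsUnique_standardInvolution : ∃! om : SymFun ≃+* SymFun, IsStandardInvolution om := by
  refine ⟨omegaEquiv.toRingEquiv, fun k => ⟨omegaHom_e k, omegaHom_h k⟩, fun om hom => ?_⟩
  have : (om : SymFun →+* SymFun) = (omegaEquiv.toRingEquiv : SymFun →+* SymFun) :=
    ringHom_ext_e fun k => (hom k).1.trans (omegaHom_e k).symm
  ext1 x
  exact congrArg (fun F : SymFun →+* SymFun => F x) this

/-- The ring of symmetric functions is the polynomial ring in `h₁, h₂, …`. -/
noncomputable def hEquiv : MvPolynomial ℕ ℤ ≃ₐ[ℤ] SymFun := eEquiv.trans omegaEquiv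

theorem hEquiv_X (i : ℕ) : hEquiv (X i) = h (i + 1) := by
  rw [hEquiv, AlgEquiv.trans_apply, eEquiv_X]
  exact omegaHom_e _

/-- The basis `(h_λ)`. -/
noncomputable def hBasis : Module.Basis Ptn ℤ SymFun := partBasis hEquiv

theorem hBasis_apply (lam : Ptn) : hBasis lam = hPart lam := partBasis_apply hEquiv_X lam

/-- As `(m_λ)` is a basis, the duality relations amount to saying that pairing with `h_λ` extracts
the coefficient of `m_λ`. -/
theorem isStandardForm_iff (B : LinearMap.BilinForm ℤ SymFun) :
    IsStandardForm B ↔ ∀ lam, B (hPart lam) = mCoeff lam := by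
  refine ⟨fun hB lam => mBasis.ext fun mu => ?_, fun hB lam mu => ?_⟩
  · rw [mBasis_apply, hB, mCoeff_m]
  · rw [hB, mCoeff_m]

theorem existsUnique_standardForm : ∃! B : LinearMap.BilinForm ℤ SymFun, IsStandardForm B := by
  refine ⟨hBasis.constr ℤ mCoeff, ?_, fun B hB => hBasis.ext fun lam => ?_⟩
  · refine (isStandardForm_iff _).2 fun lam => ?_
    rw [← hBasis_apply, Module.Basis.constr_basis]
  · rw [Module.Basis.constr_basis, hBasis_apply, (isStandardForm_iff B).1 hB]

theorem IsStandardForm.apply_m {B : LinearMap.BilinForm ℤ SymFun} (hB : IsStandardForm B)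
    (f : SymFun) (mu : Ptn) : B f (m mu) = hBasis.coord mu f := by
  have : B.flip (m mu) = hBasis.coord mu := by
    refine hBasis.ext fun lam => ?_
    change B (hBasis lam) (m mu) = _
    rw [hBasis_apply, hB, Module.Basis.coord_apply, ← hBasis_apply,
      Module.Basis.repr_self, Finsupp.single_apply]
  exact congrArg (fun F : SymFun →ₗ[ℤ] ℤ => F f) this

/-! ### The inverse series and the basis of products `h*_λ` -/

theorem hasSubst_X_mul (F : ℕ → SymFun) : PowerSeries.HasSubst
    (PowerSeries.X * PowerSeries.mk F : PowerSeries SymFun) :=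
  PowerSeries.HasSubst.of_constantCoeff_zero' (by simp)

theorem hStar_zero : hStar 0 = 1 := by
  rw [hStar]
  simp

/-- The endomorphism of `Λ` that sends `h_k` to `h*_k`. -/
noncomputable def starHom : SymFun →ₐ[ℤ] SymFun :=
  (aeval fun i => hStar (i + 1)).comp hEquiv.symm.toAlgHom

theorem starHom_h (k : ℕ) : starHom (h k) = hStar k := by
  cases k with
  | zero => rw [h_zero, hStar_zero, map_one]
  | succ k =>
    rw [← hEquiv_X]
    simp [starHom]

theorem map_starHom_uSeries : PowerSeries.map (starHom : SymFun →+* SymFun) uSeries =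
    PowerSeries.X * PowerSeries.mk hStar := by
  rw [uSeries, map_mul, PowerSeries.map_X]
  congr 1
  ext1 k
  simp only [PowerSeries.coeff_map, PowerSeries.coeff_mk]
  exact starHom_h k

/-- The relation defining `h*` is transported by the endomorphism `h_k ↦ h*_k`: the image of the
inverse series is a left inverse of the inverse series. -/
theorem map_starHom_subst : (PowerSeries.map (starHom : SymFun →+* SymFun)
    (PowerSeries.X * PowerSeries.mk hStar)).subst
    (PowerSeries.X * PowerSeries.mk hStar : PowerSeries SymFun) =
    (PowerSeries.X : PowerSeries SymFun) := by
  have hU : PowerSeries.HasSubst uSeries := hasSubst_X_mul h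
  have h1 := congrArg (PowerSeries.map (starHom : SymFun →+* SymFun)) hStar_spec
  rw [PowerSeries.map_X] at h1
  have h2 := PowerSeries.map_subst hU (h := (starHom : SymFun →+* SymFun))
    (PowerSeries.X * PowerSeries.mk hStar)
  rw [← map_starHom_uSeries] at h1 h2 ⊢
  exact h2.symm.trans h1

/-- Substituting `u` into the previous relation cancels the inverse series, leaving `u`. So `h_k ↦
h*_k` is an involution, which makes the `h*_k` free generators too. -/
theorem map_starHom_star : PowerSeries.map (starHom : SymFun →+* SymFun)
    (PowerSeries.X * PowerSeries.mk hStar) = uSeries := by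
  have hU : PowerSeries.HasSubst uSeries := hasSubst_X_mul h
  have h3 := congrArg (PowerSeries.subst uSeries) map_starHom_subst
  rw [PowerSeries.subst_comp_subst_apply (hasSubst_X_mul hStar) hU, hStar_spec,
    PowerSeries.X_subst, PowerSeries.subst_X hU] at h3
  exact h3

theorem uSeries_subst_star : uSeries.subst
    (PowerSeries.X * PowerSeries.mk hStar : PowerSeries SymFun) =
    (PowerSeries.X : PowerSeries SymFun) := by
  rw [← map_starHom_star, map_starHom_subst]

theorem starHom_hStar (k : ℕ) : starHom (hStar k) = h k := by
  have := congrArg (PowerSeries.coeff (k + 1)) map_starHom_star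
  rw [uSeries, map_mul, PowerSeries.map_X, PowerSeries.coeff_succ_X_mul,
    PowerSeries.coeff_succ_X_mul, PowerSeries.coeff_map, PowerSeries.coeff_mk,
    PowerSeries.coeff_mk] at this
  exact this

theorem starHom_starHom (f : SymFun) : starHom (starHom f) = f := by
  have h1 : ((starHom.comp starHom).comp hEquiv.toAlgHom) = hEquiv.toAlgHom := by
    ext1 i
    change starHom (starHom (hEquiv (X i))) = hEquiv (X i)
    rw [hEquiv_X, starHom_h, starHom_hStar]
  have := congrArg (fun F : MvPolynomial ℕ ℤ →ₐ[ℤ] SymFun => F (hEquiv.symm f)) h1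
  simpa using this

/-- The involution of `Λ` that exchanges `h_k` and `h*_k`. -/
noncomputable def starEquiv : SymFun ≃ₐ[ℤ] SymFun :=
  AlgEquiv.ofAlgHom starHom starHom (AlgHom.ext starHom_starHom) (AlgHom.ext starHom_starHom)

/-- The basis `(h*_λ)`. -/
noncomputable def hStarBasis : Module.Basis Ptn ℤ SymFun := partBasis (hEquiv.trans starEquiv)

theorem hStarBasis_apply (lam : Ptn) : hStarBasis lam = hStarPart lam :=
  partBasis_apply (fun i => by
    rw [AlgEquiv.trans_apply, hEquiv_X]
    exact starHom_h _) lam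

/-- Lagrange inversion in recursive form: `F = ∑ h*_k z^(k+1)` satisfies
`F = z ∑ (-1)^k e_k F^k`. -/
theorem hStar_eq_sum {m N : ℕ} (hm : m < N) : hStar m = ∑ k ∈ Finset.range N,
    (-1) ^ k * e k * PowerSeries.coeff m ((PowerSeries.X * PowerSeries.mk hStar) ^ k) := by
  set A : PowerSeries SymFun := PowerSeries.X * PowerSeries.mk hStar with hA'
  have hA : PowerSeries.HasSubst A := hasSubst_X_mul hStar
  -- `A` is the inverse of `u = t H(t)`, so `A H(A) = X`; together with `H(A) E(-A) = 1` this gives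
  -- `A = X E(-A)`, whose coefficients are compared.
  have h1 : A * hSeries.subst A = PowerSeries.X := by
    have := uSeries_subst_star
    rwa [uSeries, PowerSeries.subst_mul hA, PowerSeries.subst_X hA] at this
  have h2 : (hSeries.subst A : PowerSeries SymFun) *
      (PowerSeries.rescale (-1) eSeries).subst A = 1 := by
    rw [← PowerSeries.subst_mul hA, hSeries_mul, ← PowerSeries.coe_substAlgHom hA, map_one]
  have h3 : A = PowerSeries.X * (PowerSeries.rescale (-1) eSeries).subst A := by
    rw [← h1, mul_assoc, h2, mul_one]
  have h4 := congrArg (PowerSeries.coeff (m + 1)) h3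
  rw [hA', PowerSeries.coeff_succ_X_mul, PowerSeries.coeff_mk, ← hA', PowerSeries.coeff_succ_X_mul,
    PowerSeries.coeff_subst' hA, finsum_eq_sum_of_support_subset (s := Finset.range N)] at h4
  · rw [h4]
    refine Finset.sum_congr rfl fun k _ => ?_
    simp only [PowerSeries.coeff_rescale, eSeries, PowerSeries.coeff_mk, smul_eq_mul]
  · intro k hk
    by_contra hk'
    simp only [Finset.coe_range, Set.mem_Iio, not_lt] at hk'
    refine hk ?_
    dsimp only
    rw [hA', mul_pow, PowerSeries.coeff_X_pow_mul', if_neg (by omega), smul_zero]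

/-! ### Homogeneity of `h*_λ` and the dual family -/

theorem isHomog_coeff_pow (j k : ℕ) : IsHomog (PowerSeries.coeff k (hSeries ^ j)) k := by
  induction j generalizing k with
  | zero =>
    rw [pow_zero, PowerSeries.coeff_one]
    split_ifs with hk
    · rw [hk]
      exact isHomog_one
    · exact isHomog_zero _
  | succ j ih =>
    rw [pow_succ, PowerSeries.coeff_mul]
    refine isHomog_sum _ _ _ fun p hp => ?_
    rw [← Finset.HasAntidiagonal.mem_antidiagonal.1 hp]
    refine (ih p.1).mul ?_
    rw [hSeries, PowerSeries.coeff_mk]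
    exact isHomog_h _

theorem isHomog_hStar (k : ℕ) : IsHomog (hStar k) k := by
  induction k using Nat.strong_induction_on with
  | _ k ih =>
    rw [hStar]
    refine IsHomog.sub ?_ (isHomog_sum _ _ _ fun i _ => ?_)
    · split_ifs with hk
      · rw [hk]
        exact isHomog_one
      · exact isHomog_zero _
    · have h1 := ih i.1 i.2
      have h2 := isHomog_coeff_pow (i.1 + 1) (k - i.1)
      have h3 := h1.mul h2
      have hi := i.2
      rw [Nat.add_sub_cancel' hi.le] at h3
      change IsHomog (_ * PowerSeries.coeff (k + 1) ((PowerSeries.X * hSeries) ^ (i.1 + 1))) k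
      rw [mul_pow, PowerSeries.coeff_X_pow_mul', if_pos (by omega), Nat.add_sub_add_right]
      exact h3

theorem isHomog_hStarPart (lam : Ptn) : IsHomog (hStarPart lam) lam.1 :=
  isHomog_part isHomog_hStar lam

/-- The coordinates of a homogeneous element in a homogeneous basis. -/
theorem IsHomog.coord_eq_zero {b : Module.Basis Ptn ℤ SymFun} (hb : ∀ lam, IsHomog (b lam) lam.1)
    {f : SymFun} {d : ℕ} (hf : IsHomog f d) {lam : Ptn} (h : lam.1 ≠ d) : b.coord lam f = 0 := by
  -- This part of the expansion is the component of `f` in degree `lam.1`, which is zero since `f`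
  -- lives in degree `d`.
  have h1 : ∑ mu ∈ (b.repr f).support with mu.1 = lam.1, b.repr f mu • b mu = 0 := by
    refine ext_level fun n => ?_
    have h2 := congrArg (fun g => homogeneousComponent lam.1 (level n g))
      (b.linearCombination_repr f)
    simp only [Finsupp.linearCombination_apply, Finsupp.sum, map_sum, map_smul] at h2
    rw [map_sum, map_zero, Finset.sum_filter]
    rw [homogeneousComponent_of_mem (p := level n f) (hf n), if_neg h] at h2
    refine Eq.trans (Finset.sum_congr rfl fun mu _ => ?_) h2
    rw [homogeneousComponent_of_mem (p := level n (b mu)) (hb mu n)]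
    simp only [eq_comm (a := lam.1)]
    split_ifs
    · rw [map_smul]
    · rw [smul_zero]
  by_contra hne
  have h3 := congrArg (b.coord lam) h1
  have h4 : lam ∈ (b.repr f).support.filter fun mu => mu.1 = lam.1 := by
    simpa using hne
  rw [map_sum, map_zero, Finset.sum_eq_single_of_mem lam h4] at h3
  · simp only [map_smul, Module.Basis.coord_apply, Module.Basis.repr_self, Finsupp.single_eq_same,
      smul_eq_mul, mul_one] at h3
    exact hne h3
  · intro mu _ hmu
    rw [map_smul, Module.Basis.coord_apply, Module.Basis.repr_self, Finsupp.single_apply,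
      if_neg hmu, smul_zero]

theorem IsStandardForm.apply_hStarPart_eq_zero {B : LinearMap.BilinForm ℤ SymFun}
    (hB : IsStandardForm B) (lam mu : Ptn) (h : lam.1 ≠ mu.1) : B (hPart lam) (hStarPart mu) = 0 := by
  rw [(isStandardForm_iff B).1 hB]
  exact (isHomog_hStarPart mu).mCoeff_eq_zero h

theorem isDualToHStar_iff {B : LinearMap.BilinForm ℤ SymFun} {g : Ptn → SymFun} :
    IsDualToHStar B g ↔ ∀ lam, B (g lam) = hStarBasis.coord lam := by
  refine ⟨fun hg lam => hStarBasis.ext fun mu => ?_, fun hg lam mu => ?_⟩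
  · rw [hStarBasis_apply, hg, Module.Basis.coord_apply, ← hStarBasis_apply,
      Module.Basis.repr_self, Finsupp.single_apply]
    simp [eq_comm]
  · rw [hg, ← hStarBasis_apply, Module.Basis.coord_apply,
      Module.Basis.repr_self, Finsupp.single_apply]
    simp [eq_comm]

/-- The pairings with the `m_μ` are the coordinates in the basis `(h_μ)`. This nondegeneracy gives
both the uniqueness of `(g_λ)` and the injectivity of evaluation. -/
theorem IsStandardForm.injective {B : LinearMap.BilinForm ℤ SymFun} (hB : IsStandardForm B) :
    Function.Injective B := by
  intro f g hfg
  refine hBasis.ext_elem fun mu => ?_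
  rw [← Module.Basis.coord_apply, ← Module.Basis.coord_apply, ← hB.apply_m, ← hB.apply_m, hfg]

theorem existsUnique_dualToHStar {B : LinearMap.BilinForm ℤ SymFun} (hB : IsStandardForm B) :
    ∃! g : Ptn → SymFun, IsDualToHStar B g := by
  have h0 : IsDualToHStar B
      -- The pairing with `m_ν` reads off the coefficient of `h_ν`, and it has to be the
      -- `h*_λ`-coordinate of `m_ν`. By homogeneity that coordinate vanishes unless `|ν| = |λ|`, so
      -- a finite sum suffices.
      fun lam => ∑ nu ∈ ptnsLE lam.1, hStarBasis.coord lam (m nu) • hPart nu := by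
    rw [isDualToHStar_iff]
    intro lam
    refine mBasis.ext fun mu => ?_
    rw [mBasis_apply]
    simp only [map_sum, map_smul, LinearMap.sum_apply, LinearMap.smul_apply, hB _ _, smul_eq_mul,
      mul_ite, mul_one, mul_zero, Finset.sum_ite_eq', mem_ptnsLE]
    split_ifs with h
    · rfl
    · refine (IsHomog.coord_eq_zero (fun lam => ?_) (isHomog_m mu) (by omega)).symm
      rw [hStarBasis_apply]
      exact isHomog_hStarPart lam
  refine ⟨_, h0, fun g hg => funext fun lam => hB.injective ?_⟩
  rw [isDualToHStar_iff.1 hg, isDualToHStar_iff.1 h0]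

end SymFun

/-! ### Permutations by modified type -/

/-- The modified cycle type of a permutation, as a partition. -/
def permType {n : ℕ} (x : Equiv.Perm (Fin n)) : Ptn :=
  Ptn.ofParts (modType x) fun a ha => by
    obtain ⟨b, hb, rfl⟩ := Multiset.mem_map.1 ha
    have := Equiv.Perm.two_le_of_mem_cycleType hb
    omega

theorem permType_eq_iff {n : ℕ} {x : Equiv.Perm (Fin n)} {lam : Ptn} :
    permType x = lam ↔ modType x = lam.2.parts := Ptn.ofParts_eq_iff

theorem permType_conj {n : ℕ} (g x : Equiv.Perm (Fin n)) : permType (g * x * g⁻¹) = permType x := by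
  rw [permType_eq_iff, modType_conj]
  rfl

theorem permType_permSucc {n : ℕ} (x : Equiv.Perm (Fin n)) :
    permType (permSucc x) = permType x := by
  rw [permType_eq_iff, permSucc, modType_extend]
  rfl

theorem exists_permType_eq (lam : Ptn) : ∃ (n : ℕ) (x : Equiv.Perm (Fin n)), permType x = lam := by
  have h := (Equiv.Perm.exists_with_cycleType_iff (Fin (lam.2.parts.map (· + 1)).sum)
    (m := lam.2.parts.map (· + 1))).2 ⟨by simp, fun a ha => by
      obtain ⟨b, hb, rfl⟩ := Multiset.mem_map.1 ha
      have := lam.2.parts_pos hb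
      omega⟩
  obtain ⟨x, hx⟩ := h
  refine ⟨_, x, ?_⟩
  rw [permType_eq_iff, modType, hx, Multiset.map_map]
  simp

/-! ### Coefficients of symmetric functions of Jucys–Murphy elements -/

namespace SymFun

open MvPolynomial

/-- Evaluation of symmetric functions at the negated Jucys–Murphy elements. -/
noncomputable def jmHom (n : ℕ) : SymFun →+* GrGroupRing n :=
  (evalCommuting (fun j => -GrGroupRing.jm j)
    (fun i j => ((GrGroupRing.jm_commute i j).neg_left).neg_right)).comp
    (level n : SymFun →+* MvPolynomial (Fin n) ℤ)

theorem jmHom_apply (n : ℕ) (f : SymFun) : jmHom n f = jmEval n f := rfl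

/-- Evaluation of a symmetric function at finitely many integers. -/
noncomputable def evalAt {r : ℕ} (t : Fin r → ℤ) : SymFun →+* ℤ :=
  (eval t).comp (level r : SymFun →+* MvPolynomial (Fin r) ℤ)

theorem prod_one_add_mul_evalAt {A : Type*} [CommRing A] {r : ℕ} (t : Fin r → ℤ) (y : A) {N : ℕ}
    (hN : r < N) :
    ∏ i, (1 + y * (t i : A)) = ∑ k ∈ Finset.range N, (evalAt t (e k) : A) * y ^ k := by
  have h : ∀ k, evalAt t (e k) = ∑ s ∈ Finset.powersetCard k (Finset.univ : Finset (Fin r)),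
      ∏ i ∈ s, t i := by
    intro k
    change eval t (esymm (Fin r) ℤ k) = _
    simp only [esymm, map_sum, map_prod, eval_X]
  rw [prod_one_add_mul]
  simp only [h]
  rw [← Finset.sum_subset (Finset.range_subset_range.2 (show r + 1 ≤ N by omega))]
  · refine Finset.sum_congr rfl fun k _ => ?_
    push_cast
    ring
  · intro k _ hk
    rw [Finset.powersetCard_eq_empty.2]
    · simp
    · simpa using hk

/-- Both sides are `∏_{i,j} (1 + t_i x_j)`, expanded along the `t_i` on the left and along the `x_j`
on the right. The bounds `N` and `M` are free because the elementary polynomials vanish beyond the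
number of variables. -/
theorem prod_sum_evalAt {r n N M : ℕ} (t : Fin r → ℤ) (hN : r < N) (hM : n < M) :
    ∏ j : Fin n, ∑ k ∈ Finset.range N, C (evalAt t (e k)) * (X j : MvPolynomial (Fin n) ℤ) ^ k =
      ∑ q ∈ Fintype.piFinset fun _ : Fin r => Finset.range M,
        C (∏ i, t i ^ q i) * level n (∏ i, e (q i)) := by
  have h1 : ∀ j : Fin n, ∑ k ∈ Finset.range N,
      C (evalAt t (e k)) * (X j : MvPolynomial (Fin n) ℤ) ^ k = ∏ i, (1 + X j * C (t i)) := by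
    intro j
    have := prod_one_add_mul_evalAt t (X j : MvPolynomial (Fin n) ℤ) hN
    simp only [← eq_intCast (C : ℤ →+* MvPolynomial (Fin n) ℤ)] at this
    exact this.symm
  have h2 : ∀ i : Fin r, ∏ j : Fin n, (1 + X j * C (t i)) =
      ∑ k ∈ Finset.range M, C (t i ^ k) * level n (e k) := by
    intro i
    have := prod_one_add_mul (X : Fin n → MvPolynomial (Fin n) ℤ) (C (t i))
    simp only [mul_comm (C (t i)) (X _)] at this
    rw [this, ← Finset.sum_subset (Finset.range_subset_range.2 (show n + 1 ≤ M by omega))]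
    · refine Finset.sum_congr rfl fun k _ => ?_
      rw [C_pow]
      rfl
    · intro k _ hk
      change _ * esymm (Fin n) ℤ k = 0
      rw [esymm, Finset.powersetCard_eq_empty.2, Finset.sum_empty, mul_zero]
      simpa using hk
  simp only [h1]
  rw [Finset.prod_comm]
  simp only [h2]
  rw [Finset.prod_univ_sum]
  refine Finset.sum_congr rfl fun q _ => ?_
  rw [Finset.prod_mul_distrib, map_prod, map_prod]

/-- The coefficients of products of elementary symmetric functions of the negated Jucys–Murphy
elements are the coefficients of monomials in the products `h*_λ`. -/
theorem jmHom_prod_e {n r : ℕ} (d : Fin r →₀ ℕ) (x : Equiv.Perm (Fin n)) :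
    jmHom n (∏ i, e (d i)) x = mCoeff (expType d) (hStarPart (permType x)) := by
  -- `M` exceeds `n`, so that no `e_k` in `n` variables is lost, and every `d i`, so that `d` itself
  -- is among the exponents summed over.
  set M := n + 1 + ∑ i, d i with hM
  set S := Fintype.piFinset fun _ : Fin r => Finset.range M
  have key : level r (hStarPart (permType x)) = ∑ q ∈ S,
      monomial (Finsupp.equivFunOnFinite.symm q) (jmHom n (∏ i, e (q i)) x) := by
    -- An identity of polynomials in `t` may be checked at integer points, where the weights become
    -- integers as the graded group ring requires.
    refine MvPolynomial.funext fun t => ?_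
    have h1 : eval t (level r (hStarPart (permType x))) =
        cycleWeight (fun k => evalAt t (hStar k)) x := by
      change evalAt t _ = _
      rw [hStarPart, map_multiset_prod, Multiset.map_map]
      rfl
    rw [h1, ← GrGroupRing.evalCommuting_prod_apply (fun k => evalAt t (hStar k))
      -- The bound `r + 1 + n` exceeds `r`, beyond which `e_k(t) = 0`, and every `m < n` for which
      -- the recursion of `h*` is used.
      (by rw [hStar_zero, map_one]) (fun k => evalAt t (e k)) (r + 1 + n) ?_
      (fun i j => ((GrGroupRing.jm_commute i j).neg_left).neg_right),
      prod_sum_evalAt (M := M) t (by omega) (by omega), map_sum, GrGroupRing.sum_apply, map_sum]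
    · refine Finset.sum_congr rfl fun q _ => ?_
      rw [map_mul, ← algebraMap_eq, eq_intCast, map_intCast, eval_monomial,
        Finsupp.prod_fintype _ _ (fun _ => pow_zero _), mul_comm (jmHom n _ x), ← zsmul_eq_mul]
      rfl
    · intro m hm
      rw [hStar_eq_sum (show m < r + 1 + n by omega), map_sum]
      refine Finset.sum_congr rfl fun k _ => ?_
      rw [map_mul, map_mul, map_pow, map_neg, map_one, ← PowerSeries.coeff_map, map_pow, map_mul,
        PowerSeries.map_X]
      congr 4
  rw [mCoeff_expType, ← level_apply, key, coeff_sum,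
    Finset.sum_eq_single (Finsupp.equivFunOnFinite d)]
  · simp
  · intro q _ hq
    rw [coeff_monomial, if_neg]
    rintro rfl
    exact hq (by simp)
  · intro hd
    refine absurd ?_ hd
    simp only [S, Fintype.mem_piFinset, Finset.mem_range]
    intro i
    have := Finset.single_le_sum (f := fun i => d i) (fun _ _ => Nat.zero_le _) (Finset.mem_univ i)
    change d i < M
    omega

theorem omegaHom_hPart (lam : Ptn) : omegaHom (hPart lam) = (lam.2.parts.map e).prod := by
  rw [hPart, map_multiset_prod, Multiset.map_map]
  congr 1
  exact Multiset.map_congr rfl fun k _ => omegaHom_h k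

/-- Both sides are linear in `f`. On `h_μ`, with `ω h_μ = e_μ`, this is the equality of coefficients
already obtained from the generating function. -/
theorem IsStandardForm.jmHom_omegaHom {B : LinearMap.BilinForm ℤ SymFun} (hB : IsStandardForm B)
    (f : SymFun) {n : ℕ} (x : Equiv.Perm (Fin n)) :
    jmHom n (omegaHom f) x = B f (hStarPart (permType x)) := by
  let L : SymFun →ₗ[ℤ] ℤ := AddMonoidHom.toIntLinearMap
    { toFun := fun f => jmHom n (omegaHom f) x
      map_zero' := by rw [map_zero, map_zero, GrGroupRing.zero_apply]
      map_add' := fun f g => by rw [map_add, map_add, GrGroupRing.add_apply] }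
  have h : L = B.flip (hStarPart (permType x)) := by
    refine hBasis.ext fun lam => ?_
    change jmHom n (omegaHom (hBasis lam)) x = B (hBasis lam) _
    rw [hBasis_apply, (isStandardForm_iff B).1 hB, omegaHom_hPart]
    obtain ⟨d, hd⟩ := exists_expType_eq lam
    have h1 := jmHom_prod_e d x
    rw [hd] at h1
    rw [← h1, ← expType_eq_iff.1 hd, Multiset.map_map]
    -- Zero exponents, absent from the partition, contribute `e_0 = 1`.
    have h2 : (d.support.val.map (e ∘ d)).prod = ∏ i, e (d i) := by
      refine Finset.prod_subset (f := fun i => e (d i)) (Finset.subset_univ d.support)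
        fun i _ hi => ?_
      rw [Finsupp.notMem_support_iff.1 hi, e_zero]
    rw [h2]
  exact congrArg (fun F : SymFun →ₗ[ℤ] ℤ => F f) h

end SymFun

/-! ### The Farahat–Higman ring as the ring of symmetric functions of `-Ξ` -/

namespace FHRing

open SymFun

theorem ext_proj {F G : FHRing} (h : ∀ n, proj n F = proj n G) : F = G :=
  Subtype.ext (funext fun n => Subtype.ext (h n))

theorem proj_permSucc (F : FHRing) {n : ℕ} (x : Equiv.Perm (Fin n)) :
    proj (n + 1) F (permSucc x) = proj n F x :=
  congrFun (F.2.1 n) x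

theorem exists_lift {n m : ℕ} (h : n ≤ m) (x : Equiv.Perm (Fin n)) :
    ∃ y : Equiv.Perm (Fin m), permType y = permType x ∧ ∀ F : FHRing, proj m F y = proj n F x := by
  induction m, h using Nat.le_induction with
  | base => exact ⟨x, rfl, fun _ => rfl⟩
  | succ m h ih =>
    obtain ⟨y, hy1, hy2⟩ := ih
    exact ⟨permSucc y, by rw [permType_permSucc, hy1], fun F => by rw [proj_permSucc, hy2]⟩

/-- Both permutations are moved into a common symmetric group, where equal modified types give equal
cycle types, hence conjugate elements. -/
theorem proj_eq_of_permType (F : FHRing) {n m : ℕ} {x : Equiv.Perm (Fin n)}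
    {y : Equiv.Perm (Fin m)} (h : permType x = permType y) : proj n F x = proj m F y := by
  obtain ⟨x', hx1, hx2⟩ := exists_lift (le_max_left n m) x
  obtain ⟨y', hy1, hy2⟩ := exists_lift (le_max_right n m) y
  have h1 : modType x' = modType y' := permType_eq_iff.1 (hx1.trans (h.trans hy1.symm))
  have h2 : ∀ z : Equiv.Perm (Fin (max n m)), z.cycleType = (modType z).map (· + 1) := by
    intro z
    rw [modType, Multiset.map_map]
    conv_lhs => rw [← Multiset.map_id z.cycleType]
    refine Multiset.map_congr rfl fun a ha => ?_
    have := Equiv.Perm.two_le_of_mem_cycleType ha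
    simp only [Function.comp_apply, id_eq]
    omega
  obtain ⟨g, hg⟩ := isConj_iff.1
    (Equiv.Perm.isConj_iff_cycleType_eq.2 ((h2 x').trans ((congrArg _ h1).trans (h2 y').symm)))
  rw [← hx2, ← hy2, ← hg]
  exact ((F.1 (max n m)).2 g x').symm

theorem proj_K (lam : Ptn) {n : ℕ} (x : Equiv.Perm (Fin n)) :
    proj n (K lam) x = if permType x = lam then 1 else 0 := by
  simp only [permType_eq_iff]
  rfl

/-- The coefficient at a permutation. -/
def coeffAt {n : ℕ} (x : Equiv.Perm (Fin n)) : FHRing →ₗ[ℤ] ℤ :=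
  AddMonoidHom.toIntLinearMap
    { toFun := fun F => proj n F x
      map_zero' := by rw [map_zero, GrGroupRing.zero_apply]
      map_add' := fun F G => by rw [map_add, GrGroupRing.add_apply] }

theorem coeffAt_apply {n : ℕ} (x : Equiv.Perm (Fin n)) (F : FHRing) :
    coeffAt x F = proj n F x := rfl

theorem ext_coeffAt {F G : FHRing} (h : ∀ (n : ℕ) (x : Equiv.Perm (Fin n)),
    coeffAt x F = coeffAt x G) : F = G :=
  ext_proj fun n => GrGroupRing.ext fun x => h n x

/-- An element is determined by one value for each partition, and bounded degree leaves only
finitely many nonzero values. -/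
theorem mem_span_K (F : FHRing) : F ∈ Submodule.span ℤ (Set.range K) := by
  obtain ⟨N, hN⟩ := F.2.2
  choose n x hx using exists_permType_eq
  have h : F = ∑ lam ∈ ptnsLE N, coeffAt (x lam) F • K lam := by
    refine ext_coeffAt fun m y => ?_
    simp only [map_sum, map_smul, coeffAt_apply, proj_K, smul_eq_mul, mul_ite, mul_one, mul_zero,
      Finset.sum_ite_eq, mem_ptnsLE]
    split_ifs with hy
    · exact proj_eq_of_permType F (hx _).symm
    · by_contra hne
      exact hy (hN m y hne)
  rw [h]
  exact Submodule.sum_mem _ fun lam _ => Submodule.smul_mem _ _ (Submodule.subset_span ⟨lam, rfl⟩)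

/-- The element of `𝒢` whose components are the values of a symmetric function at the negated
Jucys–Murphy elements. -/
noncomputable def ofSymFun : SymFun →+* FHRing :=
  -- Coefficients depending on the modified type alone give at once conjugation invariance and
  -- compatibility with restriction; the bound `N` gives bounded degree.
  have key : ∀ f : SymFun, ∃ (c : Ptn → ℤ) (N : ℕ), (∀ lam, c lam ≠ 0 → lam.1 ≤ N) ∧
      ∀ (n : ℕ) (x : Equiv.Perm (Fin n)), jmHom n f x = c (permType x) := by
    intro f
    obtain ⟨B, hB, -⟩ := existsUnique_standardForm
    -- As `f = ω(ωf)`, the coefficients are `⟨ωf, h*_λ⟩`. By homogeneity they vanish beyond the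
    -- largest degree of an `h_λ` occurring in `ωf`.
    refine ⟨fun lam => B (omegaHom f) (hStarPart lam),
      (hBasis.repr (omegaHom f)).support.sup fun lam => lam.1, fun mu hmu => ?_, fun n x => ?_⟩
    · by_contra hlt
      refine hmu ?_
      change B (omegaHom f) (hStarPart mu) = 0
      rw [← hBasis.linearCombination_repr (omegaHom f), Finsupp.linearCombination_apply,
        Finsupp.sum, map_sum, LinearMap.sum_apply]
      refine Finset.sum_eq_zero fun lam hlam => ?_
      have := Finset.le_sup (f := fun lam : Ptn => lam.1) hlam
      rw [map_smul, LinearMap.smul_apply, hBasis_apply, hB.apply_hStarPart_eq_zero lam mu,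
        smul_zero]
      omega
    · dsimp only
      rw [← hB.jmHom_omegaHom, omegaHom_omegaHom]
  { toFun := fun f => ⟨fun n => ⟨jmHom n f, fun g x => by
        obtain ⟨c, N, -, hc⟩ := key f
        rw [hc, hc, permType_conj]⟩, fun n => by
      obtain ⟨c, N, -, hc⟩ := key f
      ext x
      change jmHom (n + 1) f (permSucc x) = jmHom n f x
      rw [hc, hc, permType_permSucc], by
      obtain ⟨c, N, hN, hc⟩ := key f
      refine ⟨N, fun n x hx => hN (permType x) ?_⟩
      rw [← hc]
      exact hx⟩
    map_one' := ext_proj fun n => map_one (jmHom n)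
    map_mul' := fun f g => ext_proj fun n => map_mul (jmHom n) f g
    map_zero' := ext_proj fun n => map_zero (jmHom n)
    map_add' := fun f g => ext_proj fun n => map_add (jmHom n) f g }

theorem proj_ofSymFun (n : ℕ) (f : SymFun) : proj n (ofSymFun f) = jmEval n f := rfl

theorem ofSymFun_omegaHom {B : LinearMap.BilinForm ℤ SymFun} {g : Ptn → SymFun}
    (hB : IsStandardForm B) (hg : IsDualToHStar B g) (lam : Ptn) :
    ofSymFun (omegaHom (g lam)) = K lam := by
  refine ext_proj fun n => GrGroupRing.ext fun x => ?_
  rw [proj_ofSymFun, ← jmHom_apply, hB.jmHom_omegaHom, hg, proj_K]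
  simp only [eq_comm]

/-- Every partition is the modified type of some permutation, so if `f(-Ξ) = 0` then `ωf` pairs to
zero with the whole basis `(h*_λ)`. -/
theorem ofSymFun_injective : Function.Injective ofSymFun := by
  rw [injective_iff_map_eq_zero]
  intro f hf
  obtain ⟨B, hB, -⟩ := existsUnique_standardForm
  have h1 : B (omegaHom f) = B 0 := by
    refine hStarBasis.ext fun lam => ?_
    obtain ⟨n, x, rfl⟩ := exists_permType_eq lam
    rw [hStarBasis_apply, ← hB.jmHom_omegaHom, omegaHom_omegaHom, jmHom_apply, ← proj_ofSymFun, hf,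
      map_zero, map_zero, GrGroupRing.zero_apply, LinearMap.zero_apply]
  rw [← omegaHom_omegaHom f, hB.injective h1, map_zero]

theorem ofSymFun_surjective : Function.Surjective ofSymFun := by
  obtain ⟨B, hB, -⟩ := existsUnique_standardForm
  obtain ⟨g, hg, -⟩ := existsUnique_dualToHStar hB
  have h : Submodule.span ℤ (Set.range K) ≤
      LinearMap.range (ofSymFun.toAddMonoidHom.toIntLinearMap) := by
    refine Submodule.span_le.2 ?_
    rintro _ ⟨lam, rfl⟩
    exact ⟨_, ofSymFun_omegaHom hB hg lam⟩
  exact fun F => h (mem_span_K F)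

/-- The ring `𝒢` consists of the symmetric functions of the negated Jucys–Murphy elements. -/
noncomputable def symFunEquiv : SymFun ≃+* FHRing :=
  RingEquiv.ofBijective ofSymFun ⟨ofSymFun_injective, ofSymFun_surjective⟩

theorem ringEquiv_ext_K {phi phi' : FHRing ≃+* SymFun} (h : ∀ lam, phi (K lam) = phi' (K lam)) :
    phi = phi' := by
  ext1 F
  have h1 : Set.EqOn (phi.toAddMonoidHom.toIntLinearMap) (phi'.toAddMonoidHom.toIntLinearMap)
      (Set.range K) := by
    rintro _ ⟨lam, rfl⟩
    exact h lam
  exact LinearMap.eqOn_span h1 (mem_span_K F)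

end FHRing

/-! ### The theorem -/

theorem jmEval_p (n k : ℕ) (hk : 1 ≤ k) :
    jmEval n (SymFun.p k hk) = GrGroupRing.negJMPower n k := by
  change evalCommuting _ _ (∑ i : Fin n, MvPolynomial.X i ^ k) = _
  rw [map_sum, GrGroupRing.negJMPower]
  refine Finset.sum_congr rfl fun j _ => ?_
  rw [map_pow, evalCommuting_X, neg_pow]

theorem theorem5p8 :
    (∃! B : LinearMap.BilinForm ℤ SymFun, SymFun.IsStandardForm B) ∧
    (∃! om : SymFun ≃+* SymFun, SymFun.IsStandardInvolution om) ∧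
    ∀ (B : LinearMap.BilinForm ℤ SymFun) (om : SymFun ≃+* SymFun),
      SymFun.IsStandardForm B → SymFun.IsStandardInvolution om →
      (∃! g : Ptn → SymFun, SymFun.IsDualToHStar B g) ∧
      ∀ g : Ptn → SymFun, SymFun.IsDualToHStar B g →
        (∃! phi : FHRing ≃+* SymFun, ∀ lam : Ptn, phi (FHRing.K lam) = g lam) ∧
        ∀ phi : FHRing ≃+* SymFun, (∀ lam : Ptn, phi (FHRing.K lam) = g lam) →
          (∀ (k : ℕ) (hk : 1 ≤ k), ∃ x : FHRing,
            (∀ n : ℕ, FHRing.proj n x = GrGroupRing.negJMPower n k) ∧ om (phi x) = SymFun.p k hk) ∧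
          (∀ k : ℕ, ∃ x : FHRing,
            (∀ n : ℕ, FHRing.proj n x = jmEval n (SymFun.e k)) ∧ om (phi x) = SymFun.e k) ∧
          (∀ k : ℕ, ∃ x : FHRing,
            (∀ n : ℕ, FHRing.proj n x = jmEval n (SymFun.h k)) ∧ om (phi x) = SymFun.h k) ∧
          (∀ lam : Ptn, ∃ x : FHRing,
            (∀ n : ℕ, FHRing.proj n x = jmEval n (SymFun.s lam)) ∧ om (phi x) = SymFun.s lam) := by
  refine ⟨SymFun.existsUnique_standardForm, SymFun.existsUnique_standardInvolution,
    fun B om hB hom => ⟨SymFun.existsUnique_dualToHStar hB, fun g hg => ?_⟩⟩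
  have hom' : ∀ f, om f = SymFun.omegaHom f := by
    obtain ⟨om', -, h⟩ := SymFun.existsUnique_standardInvolution
    intro f
    rw [h om hom, ← h SymFun.omegaEquiv.toRingEquiv fun k =>
      ⟨SymFun.omegaHom_e k, SymFun.omegaHom_h k⟩]
    rfl
  -- The isomorphism is `ω` after the inverse of evaluation; since `ω g_λ` evaluates to `K_λ`, it
  -- sends `K_λ` to `ω ω g_λ = g_λ`.
  have hK : ∀ lam, (FHRing.symFunEquiv.symm.trans SymFun.omegaEquiv.toRingEquiv) (FHRing.K lam) =
      g lam := by
    intro lam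
    rw [← FHRing.ofSymFun_omegaHom hB hg]
    change SymFun.omegaHom (FHRing.symFunEquiv.symm (FHRing.symFunEquiv _)) = _
    rw [RingEquiv.symm_apply_apply, SymFun.omegaHom_omegaHom]
  refine ⟨⟨_, hK, fun phi hphi => FHRing.ringEquiv_ext_K fun lam => ?_⟩, fun phi hphi => ?_⟩
  · rw [hphi, hK]
  -- The values on the `K_λ` determine `phi`, so the two involutions cancel for every symmetric
  -- function at once.
  · have key : ∀ f : SymFun, om (phi (FHRing.ofSymFun f)) = f := by
      intro f
      have h1 : phi = FHRing.symFunEquiv.symm.trans SymFun.omegaEquiv.toRingEquiv :=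
        FHRing.ringEquiv_ext_K fun lam => by rw [hphi, hK]
      rw [hom', h1]
      change SymFun.omegaHom (SymFun.omegaHom (FHRing.symFunEquiv.symm (FHRing.symFunEquiv f))) = f
      rw [RingEquiv.symm_apply_apply, SymFun.omegaHom_omegaHom]
    have hx : ∀ f : SymFun, ∃ x : FHRing,
        (∀ n : ℕ, FHRing.proj n x = jmEval n f) ∧ om (phi x) = f :=
      fun f => ⟨FHRing.ofSymFun f, fun n => FHRing.proj_ofSymFun n f, key f⟩
    refine ⟨fun k hk => ?_, fun k => hx _, fun k => hx _, fun lam => hx _⟩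
    obtain ⟨x, hx1, hx2⟩ := hx (SymFun.p k hk)
    exact ⟨x, fun n => by rw [hx1, jmEval_p], hx2⟩
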